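/- A $\mathsf{QAC}$ circuit of depth $D$ consists of $D$ layers, each made of gates acting on pairwise disjoint sets of qubits, where a gate is an arbitrary single-qubit unitary or a Toffoli gate $|x_1,\dots,x_k,t\rangle\mapsto|x_1,\dots,x_k,t\oplus(x_1\wedge\dots\wedge x_k)\rangle$ with any number $k$ of controls. A circuit $C$ on $n$ input qubits and $a$ ancillae $\varepsilon$-implements an $n$-qubit unitary $U$ if $\left|\langle\psi,0^a|\,C^\dagger\,(U|\psi\rangle\otimes|0^a\rangle)\right|^2\ge 1-\varepsilon$ for every $n$-qubit (unit) state $|\psi\rangle$. The width-$k$ unitaries $\mathrm{PARITY}_k$ and $\mathrm{FANOUT}_k$ on $k+1$ qubits are $$\mathrm{PARITY}_k|x_1,\dots,x_k,t\rangle=|x_1,\dots,x_k,\,t\oplus x_1\oplus\dots\oplus x_k\rangle,\qquad \mathrm{FANOUT}_k|s,x_1,\dots,x_k\rangle=|s,\,s\oplus x_1,\dots,s\oplus x_k\rangle .$$ There are absolute constants $c,A,K>0$ such that for all integers $d\ge1$ and $w\ge1$: 1. $\mathrm{PARITY}_{w}$ is $\dfrac{1}{2^{c\,d\,w}}$-implemented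 by a $\mathsf{QAC}$ circuit of depth at most $K\log_2(d+1)$ with at most $d\cdot 2^{A w}$ ancillae. 2. $\mathrm{PARITY}_{w^d}$ is $\dfrac{w^d}{2^{c\,d\,w}}$-implemented by a $\mathsf{QAC}$ circuit of depth at most $K\,d\log_2(d+1)$ with at most $d\,w^d\cdot 2^{A w}$ ancillae. 3. The same as in 2 holds for $\mathrm{FANOUT}_{w^d}$. -/

import Mathlib

/-! Quantum circuits with arbitrary single-qubit gates and Toffoli gates of unbounded arity.
The computational basis of a register of qubits indexed by `Q` is `Q → Bool`; state vectors are
functions `(Q → Bool) → ℂ`, operators are matrices indexed by basis states. -/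

namespace QAC

/-- The operator `|x⟩ ↦ |f x⟩`. -/
def basisMap {Q : Type} [Fintype Q] [DecidableEq Q] (f : (Q → Bool) → (Q → Bool)) :
    Matrix (Q → Bool) (Q → Bool) ℂ :=
  Matrix.of fun y x => if y = f x then 1 else 0

/-- The gate set: an arbitrary one-qubit unitary, or a Toffoli gate with any set of controls. -/
inductive Gate (Q : Type) : Type where
  | single (q : Q) (U : Matrix.unitaryGroup Bool ℂ) : Gate Q
  | toffoli (controls : Finset Q) (target : Q) (h : target ∉ controls) : Gate Q

/-- The set of qubits on which a gate acts. -/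
def Gate.support {Q : Type} [DecidableEq Q] : Gate Q → Finset Q
  | .single q _ => {q}
  | .toffoli S t _ => insert t S

/-- The operator of a gate on the whole register (identity on the qubits outside the support). -/
noncomputable def Gate.toMatrix {Q : Type} [Fintype Q] [DecidableEq Q] :
    Gate Q → Matrix (Q → Bool) (Q → Bool) ℂ
  | .single q U =>
      Matrix.of fun y x => if ∀ r, r ≠ q → y r = x r then U.1 (y q) (x q) else 0
  | .toffoli S t _ =>
      basisMap fun x => Function.update x t (xor (x t) (decide (∀ i ∈ S, x i = true)))

/-- One layer of a circuit: gates acting on pairwise disjoint sets of qubits. -/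
structure Layer (Q : Type) [DecidableEq Q] : Type where
  gates : List (Gate Q)
  disjoint : gates.Pairwise fun g h => Disjoint g.support h.support

/-- The operator of a layer; the gates commute, so the order of the product is immaterial. -/
noncomputable def Layer.toMatrix {Q : Type} [Fintype Q] [DecidableEq Q] (L : Layer Q) :
    Matrix (Q → Bool) (Q → Bool) ℂ :=
  (L.gates.map Gate.toMatrix).prod

/-- A circuit is a list of layers; the head of the list is applied first. -/
abbrev Circuit (Q : Type) [DecidableEq Q] : Type := List (Layer Q)

/-- The depth of a circuit is its number of layers. -/
def Circuit.depth {Q : Type} [DecidableEq Q] (C : Circuit Q) : ℕ := List.length C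

/-- The unitary operator performed by a circuit. -/
noncomputable def Circuit.toMatrix {Q : Type} [Fintype Q] [DecidableEq Q] :
    Circuit Q → Matrix (Q → Bool) (Q → Bool) ℂ
  | [] => 1
  | L :: C => Circuit.toMatrix C * L.toMatrix

/-- The vector `|ψ⟩ ⊗ |0^a⟩`. -/
def withZeros {n : ℕ} (a : ℕ) (ψ : (Fin n → Bool) → ℂ) : (Fin n ⊕ Fin a → Bool) → ℂ :=
  fun z => if ∀ j : Fin a, z (Sum.inr j) = false then ψ (fun i => z (Sum.inl i)) else 0

/-- A circuit `C` on `n` input qubits and `a` ancillae `ε`-implements the `n`-qubit operator `U`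
if `|⟨ψ, 0^a| C† (U|ψ⟩ ⊗ |0^a⟩)|² ≥ 1 - ε` for every (normalized) `n`-qubit state `ψ`. -/
def EpsImplements {n a : ℕ} (C : Circuit (Fin n ⊕ Fin a))
    (U : Matrix (Fin n → Bool) (Fin n → Bool) ℂ) (ε : ℝ) : Prop :=
  ∀ ψ : (Fin n → Bool) → ℂ, ∑ x, ‖ψ x‖ ^ 2 = 1 →
    1 - ε ≤ ‖dotProduct (star (withZeros a ψ))
      (Matrix.mulVec (Matrix.conjTranspose (Circuit.toMatrix C))
        (withZeros a (Matrix.mulVec U ψ)))‖ ^ 2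

/-- The width-`k` PARITY unitary `|x₁,…,x_k,t⟩ ↦ |x₁,…,x_k,t ⊕ x₁ ⊕ ⋯ ⊕ x_k⟩`. -/
def parityGate (k : ℕ) : Matrix (Fin (k + 1) → Bool) (Fin (k + 1) → Bool) ℂ :=
  basisMap fun x => Function.update x (Fin.last k)
    (xor (x (Fin.last k))
      (decide (Odd (Finset.univ.filter fun i : Fin k => x i.castSucc = true).card)))

/-- The width-`k` FANOUT unitary `|s,x₁,…,x_k⟩ ↦ |s,s ⊕ x₁,…,s ⊕ x_k⟩`. -/
def fanoutGate (k : ℕ) : Matrix (Fin (k + 1) → Bool) (Fin (k + 1) → Bool) ℂ :=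
  basisMap fun x i => if i = 0 then x 0 else xor (x 0) (x i)

end QAC

/-!
The circuits below are exact, so every error bound holds for them: parity of `w` bits is computed in
constant depth with `2 ^ O(w)` ancillae that return to zero, and everything else follows from that.

*Parity in constant depth.* Let `n = w + 1` and take `4 ^ n` columns of `n` ancillae (cells). If
each column is put into a superposition of `|0…0⟩` and `|1…1⟩`, with weights such that all columns
together are zero with probability exactly `1 / 2`, then changing the sign for every input `i` that
is one while the `i`-th cells of all columns are zero multiplies the all-zero half of the state by
the sign of the parity and leaves the rest alone. The state is unchanged for even parity and becomes
orthogonal to the original one for odd parity. Undoing the preparation therefore leaves the ancillae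
at zero, or in a state orthogonal to zero (`signTest_mulVec_ket_of_even`,
`signTest_mulVec_ket_of_odd`), a flip controlled by zeros transfers this to the target, and
repeating the test cleans the ancillae (`parityOp_mulVec_ket`).

*One column.* A column is prepared by the reflection in the product state `|+…+⟩`, a small
rotation of an extra qubit by angles that depend on whether the column is `|0…0⟩` or `|1…1⟩`, and
the same reflection again, both reflections being conditional on the extra qubit being zero. The
first reflection takes `|0…0⟩` slightly towards `|+…+⟩`, and the second one takes it back but for
the effect of the rotations in between. The angle at `|0…0⟩` can be tuned so that no component
along `|+…+⟩` survives (`column_mulVec`). What remains is an amplitude of order `2 ^ (-n)` at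
`|1…1⟩`, which the angle at `|1…1⟩` controls, and which `4 ^ n` columns raise to a total
probability of `1 / 2` (`exists_angles`). Reflections in product states, with a target qubit, are
Toffoli gates conjugated by one-qubit rotations (`realizesOn_ctrlRefl`).

*Trees and fanout.* The parity of `w ^ d` bits is a tree of parities of `w` bits whose intermediate
results are erased again (`HasParity.prod`, `hasParity_pow`), and fanout is parity conjugated by
Hadamard gates (`fanoutGate_mul_hadamard`).

Operators are handled as tensor products `tens` of one-qubit operators: a one-qubit gate is one, and
a Toffoli gate is the identity plus one.
-/

namespace QAC

open Matrix Finset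

set_option linter.unusedSectionVars false

/-! ### Tensor products of one-qubit operators -/

section Tensor
variable {Q : Type} [Fintype Q] [DecidableEq Q]

/-- The tensor product `⨂_q A q` of one-qubit operators. -/
def tens (A : Q → Matrix Bool Bool ℂ) : Matrix (Q → Bool) (Q → Bool) ℂ :=
  Matrix.of fun y x => ∏ q, A q (y q) (x q)

theorem tens_apply (A : Q → Matrix Bool Bool ℂ) (y x : Q → Bool) :
    tens A y x = ∏ q, A q (y q) (x q) := rfl

theorem tens_one : tens (fun _ : Q => (1 : Matrix Bool Bool ℂ)) = 1 := by
  ext y x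
  simp only [tens_apply, Matrix.one_apply, Finset.prod_ite_zero, Finset.prod_const_one, funext_iff]
  simp

theorem sum_prod_bool (f : Q → Bool → ℂ) : ∑ x : Q → Bool, ∏ q, f q (x q) = ∏ q, ∑ b, f q b := by
  rw [Finset.prod_univ_sum, Fintype.piFinset_univ]

theorem tens_mulVec_prod (A : Q → Matrix Bool Bool ℂ) (v : Q → Bool → ℂ) :
    tens A *ᵥ (fun x => ∏ q, v q (x q)) = fun y => ∏ q, (A q *ᵥ v q) (y q) := by
  ext y
  simp only [Matrix.mulVec, dotProduct, tens_apply, ← Finset.prod_mul_distrib]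
  rw [← sum_prod_bool]

theorem tens_mul (A B : Q → Matrix Bool Bool ℂ) : tens A * tens B = tens fun q => A q * B q := by
  ext y x
  simp only [tens_apply, Matrix.mul_apply, ← Finset.prod_mul_distrib]
  rw [sum_prod_bool fun q b => A q (y q) b * B q b (x q)]

theorem tens_conjTranspose (A : Q → Matrix Bool Bool ℂ) : (tens A)ᴴ = tens fun q => (A q)ᴴ := by
  ext y x
  simp [tens_apply, Matrix.conjTranspose_apply]

theorem commute_tens {A B : Q → Matrix Bool Bool ℂ} (h : ∀ q, Commute (A q) (B q)) :
    Commute (tens A) (tens B) := by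
  rw [Commute, SemiconjBy, tens_mul, tens_mul]
  congr 1
  funext q
  exact h q

/-- A sum over all basis states collapses to a sum over one bit when only the states that agree
with `y` away from `t` contribute. -/
theorem sum_eq_sum_update (y : Q → Bool) (t : Q) (f : (Q → Bool) → ℂ)
    (hf : ∀ x, f x ≠ 0 → ∀ q, q ≠ t → x q = y q) :
    ∑ x, f x = ∑ b, f (Function.update y t b) := by
  have hinj : Function.Injective (Function.update y t) := Function.update_injective y t
  rw [← Finset.sum_image (s := univ) (g := Function.update y t) (f := f) (fun a _ b _ h => hinj h)]
  refine (Finset.sum_subset (Finset.subset_univ _) fun x _ hx => ?_).symm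
  by_contra h
  refine hx (Finset.mem_image.2 ⟨x t, Finset.mem_univ _, ?_⟩)
  funext q
  by_cases hq : q = t
  · subst hq; simp
  · rw [Function.update_of_ne hq, hf x h q hq]

/-- The one-qubit factors of a controlled operator: `P` on the controls `S`, `B` on the target. -/
def ctrl (S : Finset Q) (t : Q) (P B : Matrix Bool Bool ℂ) (q : Q) : Matrix Bool Bool ℂ :=
  if q = t then B else if q ∈ S then P else 1

theorem ctrl_target (S : Finset Q) (t : Q) (P B : Matrix Bool Bool ℂ) : ctrl S t P B t = B := by
  simp [ctrl]

theorem ctrl_of_notMem {S : Finset Q} {t q : Q} (hq : q ∉ insert t S) (P B : Matrix Bool Bool ℂ) :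
    ctrl S t P B q = 1 := by
  rw [Finset.mem_insert, not_or] at hq
  simp [ctrl, hq.1, hq.2]

/-- The projector on the basis state `c` of one qubit. -/
def bitProj (c : Bool) : Matrix Bool Bool ℂ := Matrix.diagonal fun b => if b = c then 1 else 0

/-- With basis-state projectors on the controls, a controlled operator acts on the target when all
controls carry the bit `c`, and is zero otherwise. -/
theorem tens_ctrl_bitProj_mulVec {S : Finset Q} {t : Q} (ht : t ∉ S) (c : Bool)
    (B : Matrix Bool Bool ℂ) (ψ : (Q → Bool) → ℂ) (y : Q → Bool) :
    (tens (ctrl S t (bitProj c) B) *ᵥ ψ) y =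
      if ∀ q ∈ S, y q = c then ∑ b, B (y t) b * ψ (Function.update y t b) else 0 := by
  have hne : ∀ q, q ≠ t → ∀ b b', b ≠ b' → ctrl S t (bitProj c) B q b b' = 0 := by
    intro q hq b b' hb
    by_cases hS : q ∈ S <;> simp [ctrl, hq, hS, bitProj, hb]
  rw [Matrix.mulVec, dotProduct, sum_eq_sum_update y t]
  · have key : ∀ b, tens (ctrl S t (bitProj c) B) y (Function.update y t b) =
        (if ∀ q ∈ S, y q = c then 1 else 0) * B (y t) b := by
      intro b
      rw [tens_apply, ← Finset.mul_prod_erase univ _ (Finset.mem_univ t), ctrl_target,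
        Function.update_self, mul_comm]
      congr 1
      have : ∀ q ∈ univ.erase t, ctrl S t (bitProj c) B q (y q) (Function.update y t b q) =
          if q ∈ S → y q = c then 1 else 0 := by
        intro q hq
        have hq : q ≠ t := (Finset.mem_erase.1 hq).1
        rw [Function.update_of_ne hq]
        by_cases hS : q ∈ S <;> simp [ctrl, hq, hS, bitProj]
      rw [Finset.prod_congr rfl this, Finset.prod_ite_zero, Finset.prod_const_one]
      have e : (∀ q ∈ univ.erase t, q ∈ S → y q = c) ↔ ∀ q ∈ S, y q = c :=
        ⟨fun h q hq => h q (Finset.mem_erase.2 ⟨fun h => ht (h ▸ hq), Finset.mem_univ _⟩) hq,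
          fun h q _ hq => h q hq⟩
      by_cases h : ∀ q ∈ S, y q = c
      · rw [if_pos h, if_pos (e.2 h)]
      · rw [if_neg h, if_neg (mt e.1 h)]
    simp only [key]
    split_ifs <;> simp
  · intro x hx q hq
    by_contra h
    refine hx ?_
    rw [tens_apply, Finset.prod_eq_zero (Finset.mem_univ q) (hne q hq _ _ (Ne.symm h)), zero_mul]

/-- The basis state `|z⟩`. -/
def ket (z : Q → Bool) : (Q → Bool) → ℂ := Pi.single z 1

theorem mulVec_ket (M : Matrix (Q → Bool) (Q → Bool) ℂ) (z y : Q → Bool) :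
    (M *ᵥ ket z) y = M y z := by
  simp [ket]

theorem ket_apply (z y : Q → Bool) : ket z y = if y = z then 1 else 0 := by
  simp [ket, Pi.single_apply]

theorem matrix_eq_of_mulVec {M N : Matrix (Q → Bool) (Q → Bool) ℂ}
    (h : ∀ ψ, M *ᵥ ψ = N *ᵥ ψ) : M = N := Matrix.mulVec_injective (funext h)

/-! ### Gates, and the circuits that realize a given operator -/

/-- The Pauli matrix `X`. -/
def pauliX : Matrix Bool Bool ℂ := Matrix.of fun b b' => if b = b' then 0 else 1

theorem single_toMatrix (q : Q) (U : Matrix.unitaryGroup Bool ℂ) :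
    (Gate.single q U).toMatrix = tens (Function.update (fun _ => 1) q U.1) := by
  ext y x
  rw [Gate.toMatrix, Matrix.of_apply, tens_apply,
    ← Finset.mul_prod_erase univ _ (Finset.mem_univ q), Function.update_self]
  have : ∀ r ∈ univ.erase q, (Function.update (fun _ => 1) q U.1 : Q → Matrix Bool Bool ℂ) r (y r)
      (x r) = if y r = x r then 1 else 0 := by
    intro r hr
    rw [Function.update_of_ne (Finset.mem_erase.1 hr).1, Matrix.one_apply]
  rw [Finset.prod_congr rfl this, Finset.prod_ite_zero, Finset.prod_const_one]
  simp

theorem basisMap_mulVec_of_involutive {f : (Q → Bool) → (Q → Bool)} (hf : Function.Involutive f)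
    (ψ : (Q → Bool) → ℂ) : basisMap f *ᵥ ψ = ψ ∘ f := by
  ext y
  have : ∀ x, (y = f x) = (x = f y) := fun x => by
    refine propext ⟨fun h => ?_, fun h => ?_⟩ <;> rw [h, hf]
  simp [Matrix.mulVec, dotProduct, basisMap, this]

theorem toffoli_involutive {S : Finset Q} {t : Q} (ht : t ∉ S) :
    Function.Involutive fun x : Q → Bool =>
      Function.update x t (xor (x t) (decide (∀ i ∈ S, x i = true))) := by
  intro x
  have h : ∀ b, (∀ i ∈ S, Function.update x t b i = true) ↔ ∀ i ∈ S, x i = true := by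
    intro b
    refine forall₂_congr fun i hi => ?_
    rw [Function.update_of_ne fun h : i = t => ht (h ▸ hi)]
  simp [h]

theorem toffoli_toMatrix (S : Finset Q) (t : Q) (ht : t ∉ S) :
    (Gate.toffoli S t ht).toMatrix = 1 + tens (ctrl S t (bitProj true) (pauliX - 1)) := by
  refine matrix_eq_of_mulVec fun ψ => ?_
  ext y
  rw [Gate.toMatrix, basisMap_mulVec_of_involutive (toffoli_involutive ht), Matrix.add_mulVec,
    Pi.add_apply, tens_ctrl_bitProj_mulVec ht, Matrix.one_mulVec]
  by_cases h : ∀ q ∈ S, y q = true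
  · have hself : ψ y = ψ (Function.update y t (y t)) := by rw [Function.update_eq_self]
    have hd : decide (∀ i ∈ S, y i = true) = true := decide_eq_true h
    simp only [Function.comp_apply, hd]
    rw [if_pos h, hself]
    cases hy : y t <;> simp [pauliX, Matrix.one_apply]
  · simp [h]

/-- Gates are affine in tensor products that are trivial outside the support; commutation and
locality of gates are read off from this form. -/
theorem Gate.exists_tens (g : Gate Q) : ∃ A : Q → Matrix Bool Bool ℂ, (∀ q ∉ g.support, A q = 1) ∧
    (g.toMatrix = tens A ∨ g.toMatrix = 1 + tens A) := by
  cases g with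
  | single q U =>
    refine ⟨_, fun r hr => ?_, Or.inl (single_toMatrix q U)⟩
    rw [Function.update_of_ne]
    simpa [Gate.support] using hr
  | toffoli S t h =>
    exact ⟨_, fun r hr => ctrl_of_notMem hr _ _, Or.inr (toffoli_toMatrix S t h)⟩

theorem Gate.commute_of_disjoint {g h : Gate Q} (hd : Disjoint g.support h.support) :
    Commute g.toMatrix h.toMatrix := by
  obtain ⟨A, hA, hg⟩ := g.exists_tens
  obtain ⟨B, hB, hh⟩ := h.exists_tens
  have hc : Commute (tens A) (tens B) := commute_tens fun q => by
    by_cases hq : q ∈ g.support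
    · rw [hB q (Finset.disjoint_left.1 hd hq)]
      exact Commute.one_right _
    · rw [hA q hq]
      exact Commute.one_left _
  have hc1 : Commute g.toMatrix (tens B) := by
    rcases hg with hg | hg <;> rw [hg]
    · exact hc
    · exact (Commute.one_left _).add_left hc
  rcases hh with hh | hh <;> rw [hh]
  · exact hc1
  · exact (Commute.one_right _).add_right hc1

/-- The inverse of a gate. -/
def Gate.inv : Gate Q → Gate Q
  | .single q U => .single q U⁻¹
  | .toffoli S t h => .toffoli S t h

theorem Gate.support_inv (g : Gate Q) : g.inv.support = g.support := by cases g <;> rfl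

theorem pauliX_isHermitian : pauliXᴴ = pauliX := by
  ext a b; cases a <;> cases b <;> simp [pauliX]

theorem bitProj_conjTranspose (c : Bool) : (bitProj c)ᴴ = bitProj c := by
  ext a b; cases a <;> cases b <;> cases c <;> simp [bitProj]

theorem Gate.inv_toMatrix (g : Gate Q) : g.inv.toMatrix = g.toMatrixᴴ := by
  cases g with
  | single q U =>
    rw [Gate.inv, single_toMatrix, single_toMatrix, tens_conjTranspose]
    congr 1
    funext r
    by_cases h : r = q
    · subst h; simp [Matrix.star_eq_conjTranspose]
    · simp [Function.update_of_ne h]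
  | toffoli S t h =>
    rw [Gate.inv, toffoli_toMatrix, Matrix.conjTranspose_add, Matrix.conjTranspose_one,
      tens_conjTranspose]
    congr 2
    funext r
    unfold ctrl
    split_ifs <;> simp [pauliX_isHermitian, bitProj_conjTranspose]

theorem Gate.inv_mul (g : Gate Q) : g.toMatrixᴴ * g.toMatrix = 1 := by
  rw [← Gate.inv_toMatrix]
  cases g with
  | single q U =>
    rw [Gate.inv, single_toMatrix, single_toMatrix, tens_mul, ← tens_one]
    congr 1
    funext r
    by_cases h : r = q
    · subst h; simp
    · simp [Function.update_of_ne h]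
  | toffoli S t h =>
    refine matrix_eq_of_mulVec fun ψ => ?_
    have hi := toffoli_involutive h
    rw [Gate.inv, ← Matrix.mulVec_mulVec, Gate.toMatrix, basisMap_mulVec_of_involutive hi,
      basisMap_mulVec_of_involutive hi, Function.comp_assoc, hi.comp_self, Matrix.one_mulVec]
    rfl

/-- Some circuit of depth `D` all of whose gates act inside `S` performs the operator `M`. -/
def RealizesOn (S : Set Q) (D : ℕ) (M : Matrix (Q → Bool) (Q → Bool) ℂ) : Prop :=
  ∃ C : Circuit Q, C.depth = D ∧ (∀ L ∈ C, ∀ g ∈ L.gates, (g.support : Set Q) ⊆ S) ∧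
    C.toMatrix = M

theorem Circuit.toMatrix_append (C C' : Circuit Q) :
    Circuit.toMatrix (C ++ C' : Circuit Q) = Circuit.toMatrix C' * Circuit.toMatrix C := by
  induction C with
  | nil => simp [Circuit.toMatrix]
  | cons L C ih => simp only [List.cons_append, Circuit.toMatrix, ih, mul_assoc]

namespace RealizesOn

variable {S S' : Set Q} {D D' : ℕ} {M M' : Matrix (Q → Bool) (Q → Bool) ℂ}

theorem mono (h : RealizesOn S D M) (hS : S ⊆ S') : RealizesOn S' D M := by
  obtain ⟨C, h1, h2, h3⟩ := h
  exact ⟨C, h1, fun L hL g hg => (h2 L hL g hg).trans hS, h3⟩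

theorem one (S : Set Q) (D : ℕ) : RealizesOn S D (1 : Matrix (Q → Bool) (Q → Bool) ℂ) := by
  refine ⟨List.replicate D ⟨[], List.Pairwise.nil⟩, List.length_replicate .., ?_, ?_⟩
  · intro L hL g hg
    rw [List.eq_of_mem_replicate hL] at hg
    simp at hg
  · induction D with
    | zero => rfl
    | succ D ih => simp [List.replicate_succ, Circuit.toMatrix, ih, Layer.toMatrix]

/-- The operator `M' * M` applies the circuit of `M` first. -/
theorem mul (h' : RealizesOn S D' M') (h : RealizesOn S D M) : RealizesOn S (D' + D) (M' * M) := by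
  obtain ⟨C, h1, h2, h3⟩ := h
  obtain ⟨C', h1', h2', h3'⟩ := h'
  refine ⟨C ++ C', ?_, fun L hL => ?_, ?_⟩
  · simp only [Circuit.depth, List.length_append] at *
    omega
  · rcases List.mem_append.1 hL with hL | hL
    exacts [h2 L hL, h2' L hL]
  · rw [Circuit.toMatrix_append, h3, h3']

theorem of_gates (l : List (Gate Q)) (hl : l.Pairwise fun g h => Disjoint g.support h.support)
    (hS : ∀ g ∈ l, (g.support : Set Q) ⊆ S) : RealizesOn S 1 (l.map Gate.toMatrix).prod := by
  refine ⟨[⟨l, hl⟩], rfl, fun L hL => ?_, by simp [Circuit.toMatrix, Layer.toMatrix]⟩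
  rw [List.mem_singleton.1 hL]
  exact hS

theorem conjTranspose (h : RealizesOn S D M) : RealizesOn S D Mᴴ := by
  obtain ⟨C, h1, h2, h3⟩ := h
  induction C generalizing D M with
  | nil =>
    subst h1 h3
    simpa [Circuit.toMatrix, Circuit.depth] using RealizesOn.one S 0
  | cons L C ih =>
    subst h1 h3
    have hL : RealizesOn S 1 L.toMatrixᴴ := by
      have := of_gates (S := S) (L.gates.reverse.map Gate.inv) (by
        rw [List.pairwise_map, List.pairwise_reverse]
        refine L.disjoint.imp fun h => ?_
        rw [Gate.support_inv, Gate.support_inv]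
        exact h.symm) (by
        intro g hg
        obtain ⟨g', hg', rfl⟩ := List.mem_map.1 hg
        rw [Gate.support_inv]
        exact h2 L List.mem_cons_self g' (List.mem_reverse.1 hg'))
      have e : ((L.gates.reverse.map Gate.inv).map Gate.toMatrix).prod = L.toMatrixᴴ := by
        rw [Layer.toMatrix, Matrix.conjTranspose_list_prod, List.map_map, List.map_map,
          List.map_reverse]
        congr 2
        exact List.map_congr_left fun g _ => g.inv_toMatrix
      rwa [e] at this
    have := hL.mul (ih rfl (fun L' h => h2 L' (List.mem_cons_of_mem _ h)) rfl)
    rw [Circuit.toMatrix, Matrix.conjTranspose_mul]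
    convert this using 1
    simp [Circuit.depth, add_comm]

theorem conjTranspose_mul_self (h : RealizesOn S D M) : Mᴴ * M = 1 := by
  obtain ⟨C, -, -, rfl⟩ := h
  have hl : ∀ l : List (Gate Q),
      ((l.map Gate.toMatrix).prod)ᴴ * (l.map Gate.toMatrix).prod = 1 := by
    intro l
    induction l with
    | nil => simp
    | cons g l ih =>
      rw [List.map_cons, List.prod_cons, Matrix.conjTranspose_mul, Matrix.mul_assoc,
        ← Matrix.mul_assoc _ g.toMatrix, g.inv_mul, Matrix.one_mul, ih]
  induction C with
  | nil => simp [Circuit.toMatrix]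
  | cons L C ih =>
    rw [Circuit.toMatrix, Matrix.conjTranspose_mul, Matrix.mul_assoc,
      ← Matrix.mul_assoc _ (Circuit.toMatrix C), ih, Matrix.one_mul]
    exact hl L.gates

/-- Circuits of equal depth on disjoint sets of qubits run in parallel. -/
theorem par (hS : Disjoint S S') (h : RealizesOn S D M) (h' : RealizesOn S' D M') :
    RealizesOn (S ∪ S') D (M * M') := by
  obtain ⟨C, h1, h2, rfl⟩ := h
  obtain ⟨C', h1', h2', rfl⟩ := h'
  induction C generalizing D C' with
  | nil =>
    obtain rfl : C' = [] := List.length_eq_zero_iff.1 (h1'.trans h1.symm)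
    subst h1
    simpa [Circuit.toMatrix, Circuit.depth] using RealizesOn.one (S ∪ S') 0
  | cons L C ih =>
    cases C' with
    | nil => exact absurd (h1.trans h1'.symm) (by simp [Circuit.depth])
    | cons L' C' =>
      have hd : ∀ g : Gate Q, (g.support : Set Q) ⊆ S → ∀ g' : Gate Q,
          (g'.support : Set Q) ⊆ S' → Disjoint g.support g'.support := fun g hg g' hg' =>
        Finset.disjoint_coe.1 (hS.mono hg hg')
      have hL : RealizesOn (S ∪ S') 1 (L.toMatrix * L'.toMatrix) := by
        have := of_gates (S := S ∪ S') (L.gates ++ L'.gates)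
          (List.pairwise_append.2 ⟨L.disjoint, L'.disjoint, fun g hg g' hg' =>
            hd g (h2 L List.mem_cons_self g hg) g' (h2' L' List.mem_cons_self g' hg')⟩)
          (fun g hg => (List.mem_append.1 hg).elim
            (fun hg => (h2 L List.mem_cons_self g hg).trans Set.subset_union_left)
            (fun hg => (h2' L' List.mem_cons_self g hg).trans Set.subset_union_right))
        rwa [List.map_append, List.prod_append] at this
      have hC := (ih rfl (fun L' h => h2 L' (List.mem_cons_of_mem _ h)) C'
        (by simp only [Circuit.depth, List.length_cons] at *; omega)
        (fun L' h => h2' L' (List.mem_cons_of_mem _ h))).mul hL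
      have hcomm : Commute L.toMatrix (Circuit.toMatrix C') := by
        have hl : ∀ l' : List (Gate Q), (∀ g' ∈ l', (g'.support : Set Q) ⊆ S') →
            Commute L.toMatrix (l'.map Gate.toMatrix).prod := by
          intro l' hl'
          refine Commute.list_prod_right _ _ fun B hB => Commute.list_prod_left _ _ fun A hA => ?_
          obtain ⟨g', hg', rfl⟩ := List.mem_map.1 hB
          obtain ⟨g, hg, rfl⟩ := List.mem_map.1 hA
          exact Gate.commute_of_disjoint (hd g (h2 L List.mem_cons_self g hg) g' (hl' g' hg'))
        have : ∀ C' : Circuit Q, (∀ L' ∈ C', ∀ g ∈ L'.gates, (g.support : Set Q) ⊆ S') →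
            Commute L.toMatrix (Circuit.toMatrix C') := by
          intro C' hC'
          induction C' with
          | nil => exact Commute.one_right _
          | cons K C' ih =>
            exact (ih fun L' h => hC' L' (List.mem_cons_of_mem _ h)).mul_right
              (hl K.gates (hC' K List.mem_cons_self))
        exact this C' fun L' h => h2' L' (List.mem_cons_of_mem _ h)
      simp only [Circuit.toMatrix]
      have e : Circuit.toMatrix C * L.toMatrix * (Circuit.toMatrix C' * L'.toMatrix) =
          Circuit.toMatrix C * Circuit.toMatrix C' * (L.toMatrix * L'.toMatrix) := by
        simp only [Matrix.mul_assoc]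
        rw [← Matrix.mul_assoc L.toMatrix, hcomm.eq]
        simp only [Matrix.mul_assoc]
      rw [e]
      convert hC using 1
      simp only [Circuit.depth, List.length_cons] at *
      omega

theorem par_list {ι : Type} (l : List ι) (T : ι → Set Q)
    (N : ι → Matrix (Q → Bool) (Q → Bool) ℂ) (hT : l.Pairwise fun i j => Disjoint (T i) (T j))
    (h : ∀ i ∈ l, RealizesOn (T i) D (N i)) :
    RealizesOn {q | ∃ i ∈ l, q ∈ T i} D (l.map N).prod := by
  induction l with
  | nil => exact RealizesOn.one _ _
  | cons i l ih =>
    rw [List.pairwise_cons] at hT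
    have := par (S' := {q | ∃ i ∈ l, q ∈ T i}) (Set.disjoint_left.2 fun q hq ⟨j, hj, hqj⟩ =>
      Set.disjoint_left.1 (hT.1 j hj) hq hqj) (h i List.mem_cons_self)
      (ih hT.2 fun j hj => h j (List.mem_cons_of_mem _ hj))
    rw [List.map_cons, List.prod_cons]
    refine this.mono ?_
    rintro q (hq | ⟨j, hj, hq⟩)
    exacts [⟨i, List.mem_cons_self, hq⟩, ⟨j, List.mem_cons_of_mem _ hj, hq⟩]

end RealizesOn

/-- The operator `M` acts inside `S`: it couples only basis states that agree outside `S`. -/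
def Local (S : Set Q) (M : Matrix (Q → Bool) (Q → Bool) ℂ) : Prop :=
  ∀ y x, M y x ≠ 0 → ∀ q ∉ S, y q = x q

namespace Local

variable {S S' : Set Q} {M M' : Matrix (Q → Bool) (Q → Bool) ℂ}

theorem one (S : Set Q) : Local S (1 : Matrix (Q → Bool) (Q → Bool) ℂ) := by
  intro y x h q _
  rw [Matrix.one_apply] at h
  simp only [ne_eq, ite_eq_right_iff, not_forall] at h
  rw [h.1]

theorem mul (h : Local S M) (h' : Local S M') : Local S (M * M') := by
  intro y x hyx q hq
  rw [Matrix.mul_apply] at hyx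
  obtain ⟨w, -, hw⟩ := Finset.exists_ne_zero_of_sum_ne_zero hyx
  rw [h y w (left_ne_zero_of_mul hw) q hq, h' w x (right_ne_zero_of_mul hw) q hq]

theorem conjTranspose (h : Local S M) : Local S Mᴴ := by
  intro y x hyx q hq
  rw [Matrix.conjTranspose_apply] at hyx
  exact (h x y (fun h0 => hyx (by rw [h0, star_zero])) q hq).symm

theorem of_gate {g : Gate Q} (hg : (g.support : Set Q) ⊆ S) : Local S g.toMatrix := by
  obtain ⟨A, hA, h⟩ := g.exists_tens
  have ht : Local S (tens A) := by
    intro y x hyx q hq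
    rw [tens_apply, Finset.prod_ne_zero_iff] at hyx
    have := hyx q (Finset.mem_univ q)
    rw [hA q fun h => hq (hg h), Matrix.one_apply] at this
    by_contra hne
    exact this (if_neg hne)
  rcases h with h | h <;> rw [h]
  · exact ht
  · intro y x hyx q hq
    by_cases h1 : (1 : Matrix (Q → Bool) (Q → Bool) ℂ) y x = 0
    · rw [Matrix.add_apply, h1, zero_add] at hyx
      exact ht y x hyx q hq
    · exact Local.one S y x h1 q hq

/-- An operator acting inside `S` commutes with multiplication by functions of the qubits
outside `S`. -/
theorem mulVec_mul (h : Local S M) {χ : (Q → Bool) → ℂ}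
    (hχ : ∀ y x, (∀ q ∉ S, y q = x q) → χ y = χ x) (ψ : (Q → Bool) → ℂ) :
    M *ᵥ (χ * ψ) = χ * (M *ᵥ ψ) := by
  ext y
  simp only [Matrix.mulVec, dotProduct, Pi.mul_apply, Finset.mul_sum]
  refine Finset.sum_congr rfl fun x _ => ?_
  by_cases hx : M y x = 0
  · simp [hx]
  · rw [hχ y x (h y x hx)]
    ring

end Local

theorem RealizesOn.isLocal {S : Set Q} {D : ℕ} {M : Matrix (Q → Bool) (Q → Bool) ℂ}
    (h : RealizesOn S D M) : Local S M := by
  obtain ⟨C, -, h2, rfl⟩ := h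
  have hl : ∀ l : List (Gate Q), (∀ g ∈ l, (g.support : Set Q) ⊆ S) →
      Local S (l.map Gate.toMatrix).prod := by
    intro l hl
    induction l with
    | nil => exact Local.one S
    | cons g l ih =>
      rw [List.map_cons, List.prod_cons]
      exact (Local.of_gate (hl g List.mem_cons_self)).mul
        (ih fun g hg => hl g (List.mem_cons_of_mem _ hg))
  induction C with
  | nil => exact Local.one S
  | cons L C ih =>
    exact (ih fun L' h => h2 L' (List.mem_cons_of_mem _ h)).mul (hl _ (h2 L List.mem_cons_self))

end Tensor

/-! ### Toffoli gates in rotated one-qubit bases -/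

/-- The rotation of one qubit by the angle `φ`. -/
noncomputable def rotMatrix (φ : ℝ) : Matrix Bool Bool ℂ :=
  Matrix.of fun a b => if a = b then (Real.cos φ : ℂ) else
    if a then (Real.sin φ : ℂ) else -(Real.sin φ : ℂ)

theorem rotMatrix_conjTranspose (φ : ℝ) : (rotMatrix φ)ᴴ = rotMatrix (-φ) := by
  ext a b
  cases a <;> cases b <;> simp [rotMatrix, Matrix.conjTranspose_apply, -Complex.ofReal_cos,
    -Complex.ofReal_sin]

theorem cos_sq_add_sin_sq_complex (φ : ℝ) :
    (Real.cos φ : ℂ) ^ 2 + (Real.sin φ : ℂ) ^ 2 = 1 := by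
  exact_mod_cast Real.cos_sq_add_sin_sq φ

theorem rotMatrix_mul_neg (φ : ℝ) : rotMatrix φ * rotMatrix (-φ) = 1 := by
  have h := cos_sq_add_sin_sq_complex φ
  ext a b
  cases a <;> cases b <;> simp [rotMatrix, Matrix.mul_apply, -Complex.ofReal_cos,
    -Complex.ofReal_sin] <;> first | ring1 | linear_combination h

/-- The rotation of one qubit as a unitary. -/
noncomputable def rot (φ : ℝ) : Matrix.unitaryGroup Bool ℂ :=
  ⟨rotMatrix φ, Matrix.mem_unitaryGroup_iff.2 (by
    rw [Matrix.star_eq_conjTranspose, rotMatrix_conjTranspose, rotMatrix_mul_neg])⟩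

/-- The real unit vector `sin φ |0⟩ + cos φ |1⟩`; the angles `0`, `π / 4` and `π / 2` give
`|1⟩`, `|+⟩` and `|0⟩`. -/
noncomputable def tilt (φ : ℝ) (b : Bool) : ℂ := if b then (Real.cos φ : ℂ) else (Real.sin φ : ℂ)

/-- The orthogonal projector on `tilt φ`. -/
noncomputable def tiltProj (φ : ℝ) : Matrix Bool Bool ℂ :=
  Matrix.of fun a b => tilt φ a * tilt φ b

/-- The reflection of one qubit that takes `|0⟩` to `cos θ |0⟩ + sin θ |1⟩`. -/
noncomputable def refl (θ : ℝ) : Matrix Bool Bool ℂ :=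
  Matrix.of fun a b => if a = b then (if a then -(Real.cos θ : ℂ) else (Real.cos θ : ℂ))
    else (Real.sin θ : ℂ)

theorem rot_conj_bitProj (φ : ℝ) :
    rotMatrix (-φ) * bitProj true * (rotMatrix (-φ))ᴴ = tiltProj φ := by
  rw [rotMatrix_conjTranspose]
  ext a b
  cases a <;> cases b <;> simp [rotMatrix, Matrix.mul_apply, bitProj, tiltProj, tilt,
    -Complex.ofReal_cos, -Complex.ofReal_sin]

theorem rot_conj_pauliX (θ : ℝ) :
    rotMatrix (θ / 2 - Real.pi / 4) * (pauliX - 1) * (rotMatrix (θ / 2 - Real.pi / 4))ᴴ =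
      refl θ - 1 := by
  set φ := θ / 2 - Real.pi / 4 with hφ
  have hθ : θ = 2 * φ + Real.pi / 2 := by rw [hφ]; ring
  have hc : (Real.cos θ : ℂ) = -(2 * Real.sin φ * Real.cos φ) := by
    rw [hθ, Real.cos_add_pi_div_two, Real.sin_two_mul]; push_cast; ring
  have hs : (Real.sin θ : ℂ) = 2 * Real.cos φ ^ 2 - 1 := by
    rw [hθ, Real.sin_add_pi_div_two, Real.cos_two_mul]; push_cast; ring
  have h := cos_sq_add_sin_sq_complex φ
  have h1 : rotMatrix φ * (pauliX - 1) * (rotMatrix φ)ᴴ =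
      rotMatrix φ * pauliX * (rotMatrix φ)ᴴ - 1 := by
    rw [Matrix.mul_sub, Matrix.sub_mul, mul_one, rotMatrix_conjTranspose, rotMatrix_mul_neg]
  rw [h1, rotMatrix_conjTranspose]
  congr 1
  ext a b
  cases a <;> cases b <;> simp [rotMatrix, Matrix.mul_apply, pauliX, refl, hc, hs,
    -Complex.ofReal_cos, -Complex.ofReal_sin] <;>
    first | ring1 | linear_combination h | linear_combination -h

section Gates
variable {Q : Type} [Fintype Q] [DecidableEq Q]

/-- One layer performs any product of one-qubit unitaries. -/
theorem realizesOn_tens (S : Finset Q) (U : Q → Matrix.unitaryGroup Bool ℂ) :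
    RealizesOn (S : Set Q) 1 (tens fun q => if q ∈ S then (U q).1 else 1) := by
  have key : ∀ l : List Q, l.Nodup →
      ((l.map fun q => Gate.single q (U q)).map Gate.toMatrix).prod =
        tens fun q => if q ∈ l then (U q).1 else 1 := by
    intro l hl
    induction l with
    | nil => simp [tens_one]
    | cons q l ih =>
      rw [List.nodup_cons] at hl
      rw [List.map_cons, List.map_cons, List.prod_cons, ih hl.2, single_toMatrix, tens_mul]
      congr 1
      funext r
      by_cases hr : r = q
      · subst hr; simp [hl.1]
      · simp [hr]
  have h := RealizesOn.of_gates (S := (S : Set Q)) (S.toList.map fun q => Gate.single q (U q))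
    (by
      rw [List.pairwise_map]
      exact S.nodup_toList.imp fun h => by simpa [Gate.support] using h)
    (fun g hg => by
      obtain ⟨q, hq, rfl⟩ := List.mem_map.1 hg
      simpa [Gate.support] using hq)
  rw [key _ S.nodup_toList] at h
  simpa using h

/-- The reflection `refl θ` of the target `t`, controlled by the qubits of `S` being in the
state `tilt φ`. -/
noncomputable def ctrlRefl (S : Finset Q) (t : Q) (φ θ : ℝ) : Matrix (Q → Bool) (Q → Bool) ℂ :=
  1 + tens (ctrl S t (tiltProj φ) (refl θ - 1))

/-- A controlled reflection is a Toffoli gate conjugated by one-qubit rotations. -/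
theorem realizesOn_ctrlRefl {S : Finset Q} {t : Q} (ht : t ∉ S) (φ θ : ℝ) :
    RealizesOn (insert t S : Finset Q) 3 (ctrlRefl S t φ θ) := by
  have hU := realizesOn_tens (insert t S)
    fun q => if q = t then rot (θ / 2 - Real.pi / 4) else rot (-φ)
  have hT : RealizesOn ((insert t S : Finset Q) : Set Q) 1 (Gate.toffoli S t ht).toMatrix := by
    simpa using RealizesOn.of_gates [Gate.toffoli S t ht] (List.pairwise_singleton ..)
      (S := ((insert t S : Finset Q) : Set Q)) (by simp [Gate.support])
  have h := (hU.mul hT).mul hU.conjTranspose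
  have h1 := hU.conjTranspose.conjTranspose_mul_self
  rw [Matrix.conjTranspose_conjTranspose] at h1
  rw [toffoli_toMatrix, Matrix.mul_add, mul_one, Matrix.add_mul, h1, tens_mul, tens_conjTranspose,
    tens_mul] at h
  rw [ctrlRefl]
  convert h using 3
  funext q
  by_cases hq : q = t
  · subst hq
    simp only [ctrl_target, Finset.mem_insert_self, if_true]
    exact (rot_conj_pauliX θ).symm
  · by_cases hS : q ∈ S
    · simp only [ctrl, hq, hS, Finset.mem_insert, or_true, if_true, if_false]
      exact (rot_conj_bitProj φ).symm
    · simp [ctrl, hq, hS]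

theorem tiltProj_pi_div_two : tiltProj (Real.pi / 2) = bitProj false := by
  ext a b
  cases a <;> cases b <;> simp [tiltProj, tilt, bitProj, -Complex.ofReal_cos, -Complex.ofReal_sin]

/-- A reflection controlled by zeros. -/
theorem ctrlRefl_zeros_mulVec {S : Finset Q} {t : Q} (ht : t ∉ S) (θ : ℝ)
    (ψ : (Q → Bool) → ℂ) (y : Q → Bool) :
    (ctrlRefl S t (Real.pi / 2) θ *ᵥ ψ) y = if ∀ q ∈ S, y q = false then
      ∑ b, refl θ (y t) b * ψ (Function.update y t b) else ψ y := by
  rw [ctrlRefl, Matrix.add_mulVec, Pi.add_apply, tiltProj_pi_div_two, tens_ctrl_bitProj_mulVec ht,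
    Matrix.one_mulVec]
  split_ifs with h
  · simp only [Matrix.sub_apply, sub_mul, Finset.sum_sub_distrib]
    simp [Matrix.one_apply]
  · simp

/-- A sign controlled by zeros of `S` and by a one on `t`. -/
theorem ctrlRefl_sign_mulVec {S : Finset Q} {t : Q} (ht : t ∉ S)
    (ψ : (Q → Bool) → ℂ) (y : Q → Bool) :
    (ctrlRefl S t (Real.pi / 2) 0 *ᵥ ψ) y =
      (if (∀ q ∈ S, y q = false) ∧ y t = true then -1 else 1) * ψ y := by
  have hself : ψ y = ψ (Function.update y t (y t)) := by rw [Function.update_eq_self]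
  rw [ctrlRefl_zeros_mulVec ht]
  by_cases h : ∀ q ∈ S, y q = false
  · rw [if_pos h, hself]
    cases hy : y t <;> simp [refl, if_pos h]
  · rw [if_neg h, if_neg (fun h' => h h'.1), one_mul]

/-- A negation controlled by zeros. -/
theorem ctrlRefl_flip_mulVec {S : Finset Q} {t : Q} (ht : t ∉ S)
    (ψ : (Q → Bool) → ℂ) (y : Q → Bool) :
    (ctrlRefl S t (Real.pi / 2) (Real.pi / 2) *ᵥ ψ) y =
      if ∀ q ∈ S, y q = false then ψ (Function.update y t (!y t)) else ψ y := by
  rw [ctrlRefl_zeros_mulVec ht]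
  cases hy : y t <;> simp [refl, -Complex.ofReal_cos, -Complex.ofReal_sin]

end Gates

/-! ### The state of one column -/

section Column
variable {Q : Type} [Fintype Q] [DecidableEq Q]

/-- The vector `u^{⊗ R} ⊗ α` on the qubits of `R` and the qubit `g`, as a function of all the
qubits that does not depend on the others. -/
noncomputable def colVec (R : Finset Q) (g : Q) (u α : Bool → ℂ) (y : Q → Bool) : ℂ :=
  (∏ q ∈ R, u (y q)) * α (y g)

theorem colVec_eq_prod {R : Finset Q} {g : Q} (hg : g ∉ R) (u α : Bool → ℂ) :
    colVec R g u α = fun y => ∏ q, (if q = g then α else if q ∈ R then u else 1) (y q) := by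
  ext y
  rw [colVec, ← Finset.mul_prod_erase univ _ (Finset.mem_univ g), mul_comm]
  congr 1
  · simp
  · symm
    rw [← Finset.prod_subset (s₁ := R)]
    · refine Finset.prod_congr rfl fun q hq => ?_
      have : q ≠ g := fun h => hg (h ▸ hq)
      simp [this, hq]
    · intro q hq
      exact Finset.mem_erase.2 ⟨fun h => hg (h ▸ hq), Finset.mem_univ _⟩
    · intro q hq hR
      simp [(Finset.mem_erase.1 hq).1, hR]

theorem tiltProj_mulVec (φ : ℝ) (u : Bool → ℂ) :
    tiltProj φ *ᵥ u = (∑ b, tilt φ b * u b) • tilt φ := by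
  ext a
  simp [Matrix.mulVec, dotProduct, tiltProj]
  ring

theorem ctrlRefl_mulVec_colVec {R : Finset Q} {g : Q} (hg : g ∉ R) (φ θ : ℝ) (u α : Bool → ℂ) :
    ctrlRefl R g φ θ *ᵥ colVec R g u α = colVec R g u α +
      (∑ b, tilt φ b * u b) ^ R.card • colVec R g (tilt φ) ((refl θ - 1) *ᵥ α) := by
  rw [ctrlRefl, Matrix.add_mulVec, Matrix.one_mulVec]
  congr 1
  rw [colVec_eq_prod hg, tens_mulVec_prod]
  ext y
  have h : ∀ q, (ctrl R g (tiltProj φ) (refl θ - 1) q *ᵥ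
      (if q = g then α else if q ∈ R then u else 1)) (y q) =
      (if q ∈ R then ∑ b, tilt φ b * u b else 1) *
        (if q = g then (refl θ - 1) *ᵥ α else if q ∈ R then tilt φ else 1) (y q) := by
    intro q
    by_cases h1 : q = g
    · subst h1; simp [ctrl, hg]
    · by_cases h2 : q ∈ R
      · simp only [ctrl, h1, h2, if_true, if_false, tiltProj_mulVec]
        rfl
      · simp [ctrl, h1, h2]
  rw [Finset.prod_congr rfl fun q _ => h q, Finset.prod_mul_distrib, Finset.prod_ite_mem,
    Finset.univ_inter, Finset.prod_const, Pi.smul_apply, smul_eq_mul, colVec_eq_prod hg]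

theorem sum_tilt_mul_tilt (φ φ' : ℝ) : ∑ b, tilt φ b * tilt φ' b = (Real.cos (φ - φ') : ℂ) := by
  rw [Real.cos_sub]
  simp [tilt, -Complex.ofReal_cos, -Complex.ofReal_sin]

/-- Four controlled reflections, with controls in the states `|+⟩`, `|0⟩`, `|1⟩`, `|+⟩`. As `refl π`
only negates `|0⟩`, the outer two reflect the cells `R` in `|+…+⟩` when the qubit `g` is zero. -/
noncomputable def column (R : Finset Q) (g : Q) (θ₀ θ₁ : ℝ) : Matrix (Q → Bool) (Q → Bool) ℂ :=
  ctrlRefl R g (Real.pi / 4) Real.pi * (ctrlRefl R g 0 θ₁ *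
    (ctrlRefl R g (Real.pi / 2) θ₀ * ctrlRefl R g (Real.pi / 4) Real.pi))

theorem realizesOn_column {R : Finset Q} {g : Q} (hg : g ∉ R) (θ₀ θ₁ : ℝ) :
    RealizesOn (insert g R : Finset Q) 12 (column R g θ₀ θ₁) :=
  (realizesOn_ctrlRefl hg _ _).mul ((realizesOn_ctrlRefl hg _ _).mul
    ((realizesOn_ctrlRefl hg _ _).mul (realizesOn_ctrlRefl hg _ _)))

/-- The state of the extra qubit next to `|0…0⟩` at the end of `column`; `a` is the probability
`2 ^ (-n)` of `|0…0⟩` in `|+…+⟩`. -/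
noncomputable def tail₀ (a θ₀ : ℝ) (b : Bool) : ℂ :=
  if b then (1 - 2 * a) * Real.sin θ₀ else (1 - 2 * a) * Real.cos θ₀ + 2 * a

/-- The state of the extra qubit next to `|1…1⟩` at the end of `column`. -/
noncomputable def tail₁ (a θ₁ : ℝ) (b : Bool) : ℂ :=
  if b then -2 * a * Real.sin θ₁ else 2 * a * (1 - Real.cos θ₁)

/-- The relation between the angles of `column` under which its last reflection leaves no component
along `|+…+⟩`; `a` is the probability of `|0…0⟩`, and of `|1…1⟩`, in `|+…+⟩`. -/
def Balanced (a θ₀ θ₁ : ℝ) : Prop :=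
  (1 - 2 * a) * Real.cos θ₀ = 1 - 2 * a - 2 * a * (1 - Real.cos θ₁)

/-- The last reflection removes exactly the component along `|+…+⟩`: the column ends in a
superposition of `|0…0⟩` and `|1…1⟩` without any error. -/
theorem column_mulVec {R : Finset Q} {g : Q} (hg : g ∉ R) (hR : R.Nonempty) {θ₀ θ₁ : ℝ}
    (h : Balanced ((1 / 2) ^ R.card) θ₀ θ₁) :
    column R g θ₀ θ₁ *ᵥ colVec R g (tilt (Real.pi / 2)) (tilt (Real.pi / 2)) =
      colVec R g (tilt (Real.pi / 2)) (tail₀ ((1 / 2) ^ R.card) θ₀) +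
      colVec R g (tilt 0) (tail₁ ((1 / 2) ^ R.card) θ₁) := by
  set a : ℝ := (1 / 2) ^ R.card with ha
  have hC : (1 - 2 * (a : ℂ)) * (Real.cos θ₀ : ℂ) =
      1 - 2 * a - 2 * a * (1 - (Real.cos θ₁ : ℂ)) := by exact_mod_cast h
  have hn : R.card ≠ 0 := Finset.card_ne_zero.2 hR
  -- the overlap of `|+…+⟩` with `|0…0⟩` and with `|1…1⟩`
  obtain ⟨s, hs, hs2⟩ : ∃ s : ℂ, (Real.cos (Real.pi / 4) : ℂ) ^ R.card = s ∧ s ^ 2 = a := by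
    refine ⟨_, rfl, ?_⟩
    rw [← pow_mul, mul_comm, pow_mul, ha]
    norm_cast
    rw [Real.cos_pi_div_four, div_pow, Real.sq_sqrt (by norm_num)]
    norm_num
  have e1 : Real.cos (Real.pi / 4 - Real.pi / 2) = Real.cos (Real.pi / 4) := by
    rw [← Real.cos_neg]; congr 1; ring
  have e2 : Real.cos (Real.pi / 2 - Real.pi / 4) = Real.cos (Real.pi / 4) := by congr 1; ring
  have e3 : Real.cos (0 - Real.pi / 4) = Real.cos (Real.pi / 4) := by
    rw [← Real.cos_neg]; congr 1; ring
  have e4 : Real.cos (0 - Real.pi / 2) = 0 := by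
    rw [zero_sub, Real.cos_neg, Real.cos_pi_div_two]
  simp only [column, ← Matrix.mulVec_mulVec, ctrlRefl_mulVec_colVec hg, Matrix.mulVec_add,
    Matrix.mulVec_smul, sum_tilt_mul_tilt, e1, e2, e3, e4, sub_self, sub_zero, Real.cos_zero,
    Complex.ofReal_one, one_pow, Complex.ofReal_zero, zero_pow hn, hs, one_smul, zero_smul,
    add_zero]
  ext y
  simp only [Pi.add_apply, Pi.smul_apply, smul_eq_mul, colVec, tail₀, tail₁]
  rw [← hs2] at hC ⊢
  generalize ∏ q ∈ R, tilt (Real.pi / 2) (y q) = E0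
  generalize ∏ q ∈ R, tilt (Real.pi / 4) (y q) = E
  generalize ∏ q ∈ R, tilt 0 (y q) = E1
  cases y g
  · simp [Matrix.mulVec, dotProduct, refl, Matrix.one_apply, tilt, -Complex.ofReal_cos,
      -Complex.ofReal_sin]
    linear_combination (-2 * s * E) * hC
  · simp [Matrix.mulVec, dotProduct, refl, Matrix.one_apply, tilt, -Complex.ofReal_cos,
      -Complex.ofReal_sin]
    ring

end Column

/-! ### The angles -/

/-- The probability that the cells of one column are all zero. -/
theorem sum_normSq_tail₀ {a θ₀ θ₁ : ℝ}
    (h : Balanced a θ₀ θ₁) :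
    ∑ b, star (tail₀ a θ₀ b) * tail₀ a θ₀ b = ((1 - 8 * a ^ 2 * (1 - Real.cos θ₁) : ℝ) : ℂ) := by
  have hs := Real.sin_sq_add_cos_sq θ₀
  unfold Balanced at h
  have e : ∑ b, star (tail₀ a θ₀ b) * tail₀ a θ₀ b =
      ((((1 - 2 * a) * Real.sin θ₀) ^ 2 + ((1 - 2 * a) * Real.cos θ₀ + 2 * a) ^ 2 : ℝ) : ℂ) := by
    simp [tail₀, -Complex.ofReal_cos, -Complex.ofReal_sin, Complex.conj_ofNat]
    ring
  rw [e]
  congr 1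
  linear_combination (1 - 2 * a) ^ 2 * hs + 4 * a * h

/-- For `n ≥ 2` rows and `4 ^ n` columns the angles can be tuned so that a column makes no error
and all columns are `|0…0⟩` with probability exactly `1 / 2`. -/
theorem exists_angles {n : ℕ} (hn : 2 ≤ n) : ∃ θ₀ θ₁ : ℝ,
    Balanced ((1 / 2) ^ n) θ₀ θ₁ ∧
    (1 - 8 * ((1 / 2 : ℝ) ^ n) ^ 2 * (1 - Real.cos θ₁)) ^ 4 ^ n = 1 / 2 := by
  set a : ℝ := (1 / 2) ^ n with ha
  have ha0 : 0 < a := by positivity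
  have ha4 : a ≤ 1 / 4 := by
    calc a ≤ (1 / 2 : ℝ) ^ 2 := pow_le_pow_of_le_one (by norm_num) (by norm_num) hn
      _ = 1 / 4 := by norm_num
  have haN : a ^ 2 * (4 : ℝ) ^ n = 1 := by
    rw [ha, ← pow_mul, mul_comm n 2, pow_mul, ← mul_pow]
    norm_num
  have hN : (0 : ℝ) < 4 ^ n := by positivity
  -- the probability of `|0…0⟩` in one column
  set P : ℝ := Real.exp (-Real.log 2 / 4 ^ n) with hP
  have hP1 : P ≤ 1 := by
    rw [hP, Real.exp_le_one_iff, neg_div, neg_nonpos]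
    exact div_nonneg (Real.log_nonneg (by norm_num)) hN.le
  have hP2 : 1 - a ^ 2 ≤ P := by
    have h1 := Real.add_one_le_exp (-Real.log 2 / 4 ^ n)
    have h2 : Real.log 2 / 4 ^ n ≤ a ^ 2 := by
      rw [div_le_iff₀ hN, haN]
      have := Real.log_two_lt_d9
      linarith
    rw [neg_div] at h1
    rw [hP, neg_div]
    linarith
  have hPN : P ^ 4 ^ n = 1 / 2 := by
    rw [hP, ← Real.exp_nat_mul]
    push_cast
    rw [mul_div_cancel₀ _ hN.ne', Real.exp_neg, Real.exp_log (by norm_num)]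
    norm_num
  -- the value of `1 - cos θ₁` that gives each column this probability
  set k : ℝ := (1 - P) / (8 * a ^ 2) with hk
  have hk0 : 0 ≤ k := div_nonneg (by linarith) (by positivity)
  have hk1 : k ≤ 1 := by
    rw [hk, div_le_one (by positivity)]
    nlinarith
  have hc : 0 < 1 - 2 * a := by linarith
  refine ⟨Real.arccos (1 - 2 * a * k / (1 - 2 * a)), Real.arccos (1 - k), ?_, ?_⟩
  · have h1 : 2 * a * k / (1 - 2 * a) ≤ 1 := by
      rw [div_le_one hc]
      nlinarith
    have h2 : 0 ≤ 2 * a * k / (1 - 2 * a) := by positivity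
    rw [Balanced, Real.cos_arccos (by linarith) (by linarith),
      Real.cos_arccos (by linarith) (by linarith)]
    field_simp
    ring
  · rw [Real.cos_arccos (by linarith) (by linarith), ← hPN, hk]
    congr 1
    field_simp
    ring

/-! ### Products of operators acting on disjoint sets of qubits -/

section Products
variable {Q : Type} [Fintype Q] [DecidableEq Q]

/-- The function `χ` does not depend on the qubits of `S`. -/
def IndepOf (S : Set Q) (χ : (Q → Bool) → ℂ) : Prop :=
  ∀ y x, (∀ q ∉ S, y q = x q) → χ y = χ x

theorem IndepOf.mul {S : Set Q} {χ χ' : (Q → Bool) → ℂ} (h : IndepOf S χ) (h' : IndepOf S χ') :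
    IndepOf S (χ * χ') := fun y x hyx => by
  rw [Pi.mul_apply, Pi.mul_apply, h y x hyx, h' y x hyx]

theorem IndepOf.add {S : Set Q} {χ χ' : (Q → Bool) → ℂ} (h : IndepOf S χ) (h' : IndepOf S χ') :
    IndepOf S (χ + χ') := fun y x hyx => by
  rw [Pi.add_apply, Pi.add_apply, h y x hyx, h' y x hyx]

theorem IndepOf.list_prod {S : Set Q} {l : List ((Q → Bool) → ℂ)} (h : ∀ χ ∈ l, IndepOf S χ) :
    IndepOf S l.prod := by
  induction l with
  | nil => exact fun _ _ _ => rfl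
  | cons χ l ih =>
    rw [List.prod_cons]
    exact (h χ List.mem_cons_self).mul (ih fun χ hχ => h χ (List.mem_cons_of_mem _ hχ))

theorem indepOf_colVec {S : Set Q} {R : Finset Q} {g : Q}
    (h : Disjoint S (insert g R : Finset Q)) (u α : Bool → ℂ) : IndepOf S (colVec R g u α) := by
  intro y x hyx
  have hq : ∀ q ∈ insert g R, y q = x q := fun q hq =>
    hyx q fun hS => Set.disjoint_left.1 h hS hq
  rw [colVec, colVec, hq g (Finset.mem_insert_self _ _)]
  congr 1
  exact Finset.prod_congr rfl fun q h' => by rw [hq q (Finset.mem_insert_of_mem h')]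

/-- Operators on disjoint sets of qubits act factor by factor on a product. -/
theorem list_prod_mulVec {J : Type} (S : J → Set Q) (W : J → Matrix (Q → Bool) (Q → Bool) ℂ)
    (hW : ∀ j, Local (S j) (W j)) (δ φ : J → (Q → Bool) → ℂ) (hδφ : ∀ j, W j *ᵥ δ j = φ j)
    (hδ : ∀ i j, i ≠ j → IndepOf (S i) (δ j)) (hφ : ∀ i j, i ≠ j → IndepOf (S i) (φ j))
    (l : List J) (hl : l.Nodup) (χ : (Q → Bool) → ℂ) (hχ : ∀ j ∈ l, IndepOf (S j) χ) :
    (l.map W).prod *ᵥ (χ * (l.map δ).prod) = χ * (l.map φ).prod := by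
  induction l generalizing χ with
  | nil => simp
  | cons j l ih =>
    rw [List.nodup_cons] at hl
    have hne : ∀ i ∈ l, i ≠ j := fun i hi h => hl.1 (h ▸ hi)
    simp only [List.map_cons, List.prod_cons]
    rw [← Matrix.mulVec_mulVec, ← mul_assoc, ih hl.2 (χ * δ j) fun i hi =>
      (hχ i (List.mem_cons_of_mem _ hi)).mul (hδ i j (hne i hi)), mul_right_comm,
      (hW j).mulVec_mul, hδφ, mul_right_comm, mul_assoc]
    refine (hχ j List.mem_cons_self).mul (IndepOf.list_prod fun ψ hψ => ?_)
    obtain ⟨i, hi, rfl⟩ := List.mem_map.1 hψ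
    exact hφ j i (hne i hi).symm

end Products

/-! ### Exact parity in constant depth -/

/-- The parity of the bits `b i`. -/
def parityBit {ι : Type} [Fintype ι] (b : ι → Bool) : Bool :=
  decide (Odd (univ.filter fun i => b i = true).card)

theorem prod_sign_eq {ι : Type} [Fintype ι] (b : ι → Bool) :
    ∏ i, (if b i = true then (-1 : ℂ) else 1) = if parityBit b = true then -1 else 1 := by
  rw [Finset.prod_ite, Finset.prod_const, Finset.prod_const_one, mul_one, parityBit]
  by_cases h : Odd (univ.filter fun i => b i = true).card
  · simp [h, h.neg_one_pow]
  · simp [h, (Nat.not_odd_iff_even.1 h).neg_one_pow]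

section ColVec
variable {Q : Type} [Fintype Q] [DecidableEq Q]

theorem colVec_zeros_apply (R : Finset Q) (g : Q) (α : Bool → ℂ) (y : Q → Bool) :
    colVec R g (tilt (Real.pi / 2)) α y = if ∀ q ∈ R, y q = false then α (y g) else 0 := by
  have h : ∀ b, tilt (Real.pi / 2) b = if b = false then 1 else 0 := by
    intro b
    cases b <;> simp [tilt, -Complex.ofReal_cos, -Complex.ofReal_sin]
  simp only [colVec, h, Finset.prod_ite_zero, Finset.prod_const_one, ite_mul, one_mul, zero_mul]

theorem colVec_ones_apply (R : Finset Q) (g : Q) (α : Bool → ℂ) (y : Q → Bool) :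
    colVec R g (tilt 0) α y = if ∀ q ∈ R, y q = true then α (y g) else 0 := by
  have h : ∀ b, tilt 0 b = if b = true then 1 else 0 := by
    intro b
    cases b <;> simp [tilt, -Complex.ofReal_cos, -Complex.ofReal_sin]
  simp only [colVec, h, Finset.prod_ite_zero, Finset.prod_const_one, ite_mul, one_mul, zero_mul]

end ColVec

section Gadget

variable {ι J Q : Type} [Fintype ι] [Fintype J] [Fintype Q] [DecidableEq Q]
  (e : (ι ⊕ Unit) ⊕ (J × Option (Option ι)) ↪ Q)

/-- The qubit of input `i`. -/
def inputQ (i : ι) : Q := e (Sum.inl (Sum.inl i))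

/-- The target qubit. -/
def targetQ : Q := e (Sum.inl (Sum.inr ()))

/-- The ancilla in column `j` and row `r`; there is one row for each input and one more row. -/
def cellQ (j : J) (r : Option ι) : Q := e (Sum.inr (j, some r))

/-- The extra ancilla of column `j`. -/
def flagQ (j : J) : Q := e (Sum.inr (j, none))

/-- The cells of column `j`. -/
def colCells (j : J) : Finset Q := univ.image (cellQ e j)

/-- The cells in the row of input `i`. -/
def rowCells (i : ι) : Finset Q := univ.image fun j => cellQ e j (some i)

/-- All ancillae. -/
def ancillae : Finset Q := univ.image fun a => e (Sum.inr a)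

theorem flagQ_notMem (j : J) : flagQ e j ∉ colCells e j := by
  simp [flagQ, colCells, cellQ]

theorem inputQ_notMem_rowCells (i : ι) : inputQ e i ∉ rowCells e i := by
  simp [inputQ, rowCells, cellQ]

theorem targetQ_notMem_ancillae : targetQ e ∉ ancillae e := by
  simp [targetQ, ancillae]

theorem inputQ_notMem_ancillae (i : ι) : inputQ e i ∉ ancillae e := by
  simp [inputQ, ancillae]

theorem forall_ancillae {p : Q → Prop} :
    (∀ q ∈ ancillae e, p q) ↔ (∀ j r, p (cellQ e j r)) ∧ ∀ j, p (flagQ e j) := by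
  simp only [ancillae, Finset.forall_mem_image, Finset.mem_univ, forall_true_left, Prod.forall]
  exact ⟨fun h => ⟨fun j r => h j (some r), fun j => h j none⟩,
    fun h j o => by cases o; exacts [h.2 j, h.1 j _]⟩

theorem forall_colCells {p : Q → Prop} (j : J) :
    (∀ q ∈ colCells e j, p q) ↔ ∀ r, p (cellQ e j r) := by
  simp [colCells]

theorem forall_rowCells {p : Q → Prop} (i : ι) :
    (∀ q ∈ rowCells e i, p q) ↔ ∀ j, p (cellQ e j (some i)) := by
  simp [rowCells]

theorem card_colCells (j : J) : (colCells e j).card = Fintype.card ι + 1 := by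
  rw [colCells, Finset.card_image_of_injective, Finset.card_univ, Fintype.card_option]
  intro r r' h
  simpa [cellQ] using h

theorem disjoint_columns {i j : J} (h : i ≠ j) :
    Disjoint ((insert (flagQ e i) (colCells e i) : Finset Q) : Set Q)
      (insert (flagQ e j) (colCells e j) : Finset Q) := by
  rw [Finset.disjoint_coe, Finset.disjoint_left]
  intro q hq hq'
  simp only [Finset.mem_insert, colCells, Finset.mem_image, Finset.mem_univ, true_and, flagQ,
    cellQ] at hq hq'
  rcases hq with rfl | ⟨r, rfl⟩ <;> rcases hq' with hq' | ⟨r', hq'⟩ <;> simp at hq' <;>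
    exact h (by first | exact hq' | exact hq'.symm | exact hq'.1 | exact hq'.1.symm)

theorem column_subset_ancillae (j : J) :
    insert (flagQ e j) (colCells e j) ⊆ ancillae e := by
  intro q hq
  simp only [Finset.mem_insert, colCells, Finset.mem_image, Finset.mem_univ, true_and] at hq
  rcases hq with rfl | ⟨r, rfl⟩
  exacts [Finset.mem_image_of_mem _ (Finset.mem_univ _),
    Finset.mem_image_of_mem _ (Finset.mem_univ _)]

theorem colCells_nonempty (j : J) : (colCells e j).Nonempty :=
  ⟨_, Finset.mem_image_of_mem _ (Finset.mem_univ none)⟩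

/-- All columns in parallel. -/
noncomputable def columns (θ₀ θ₁ : ℝ) : Matrix (Q → Bool) (Q → Bool) ℂ :=
  ((univ : Finset J).toList.map fun j => column (colCells e j) (flagQ e j) θ₀ θ₁).prod

theorem realizesOn_columns (θ₀ θ₁ : ℝ) : RealizesOn (ancillae e) 12 (columns e θ₀ θ₁) := by
  refine (RealizesOn.par_list _ (fun j => ((insert (flagQ e j) (colCells e j) : Finset Q) : Set Q))
    _ ?_ fun j _ => realizesOn_column (flagQ_notMem e j) θ₀ θ₁).mono ?_
  · exact (Finset.nodup_toList _).imp fun h => disjoint_columns e h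
  · rintro q ⟨j, -, hq⟩
    exact column_subset_ancillae e j hq

/-- The sign change for each input that is one and whose row is zero. -/
noncomputable def rowSigns : Matrix (Q → Bool) (Q → Bool) ℂ :=
  ((univ : Finset ι).toList.map fun i =>
    ctrlRefl (rowCells e i) (inputQ e i) (Real.pi / 2) 0).prod

theorem realizesOn_rowSigns :
    RealizesOn (Set.range (inputQ e) ∪ ancillae e) 3 (rowSigns e) := by
  refine (RealizesOn.par_list _ (fun i => ((insert (inputQ e i) (rowCells e i) : Finset Q) : Set Q))
    _ ?_ fun i _ => realizesOn_ctrlRefl (inputQ_notMem_rowCells e i) _ _).mono ?_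
  · refine (Finset.nodup_toList _).imp fun {i k} h => ?_
    rw [Finset.disjoint_coe, Finset.disjoint_left]
    intro q hq hq'
    simp only [Finset.mem_insert, rowCells, Finset.mem_image, Finset.mem_univ, true_and, inputQ,
      cellQ] at hq hq'
    rcases hq with rfl | ⟨r, rfl⟩ <;> rcases hq' with hq' | ⟨r', hq'⟩ <;> simp at hq' <;>
      exact h (by first | exact hq' | exact hq'.symm | exact hq'.2 | exact hq'.2.symm)
  · rintro q ⟨i, -, hq⟩
    simp only [Finset.mem_coe, Finset.mem_insert, rowCells, Finset.mem_image, Finset.mem_univ,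
      true_and] at hq
    rcases hq with rfl | ⟨j, rfl⟩
    · exact Or.inl ⟨i, rfl⟩
    · exact Or.inr (Finset.mem_coe.2 (Finset.mem_image_of_mem _ (Finset.mem_univ _)))

/-- The sign by which `rowSigns` multiplies a basis state. -/
noncomputable def rowSign (y : Q → Bool) : ℂ :=
  ∏ i : ι, if (∀ q ∈ rowCells e i, y q = false) ∧ y (inputQ e i) = true then -1 else 1

theorem rowSigns_mulVec (ψ : (Q → Bool) → ℂ) : rowSigns e *ᵥ ψ = fun y => rowSign e y * ψ y := by
  have key : ∀ l : List ι, (l.map fun i =>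
      ctrlRefl (rowCells e i) (inputQ e i) (Real.pi / 2) 0).prod *ᵥ ψ = fun y =>
      (l.map fun i => if (∀ q ∈ rowCells e i, y q = false) ∧ y (inputQ e i) = true then (-1 : ℂ)
        else 1).prod * ψ y := by
    intro l
    induction l with
    | nil => simp
    | cons i l ih =>
      ext y
      rw [List.map_cons, List.prod_cons, ← Matrix.mulVec_mulVec, ih,
        ctrlRefl_sign_mulVec (inputQ_notMem_rowCells e i), List.map_cons, List.prod_cons, mul_assoc]
  rw [rowSigns, key]
  ext y
  rw [Finset.prod_map_toList, rowSign]

theorem rowSign_mul_self (y : Q → Bool) : rowSign e y * rowSign e y = 1 := by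
  rw [rowSign, ← Finset.prod_mul_distrib]
  refine Finset.prod_eq_one fun i _ => ?_
  split_ifs <;> simp

/-- The indicator of agreeing with `z` on all qubits except the ancillae. -/
noncomputable def away (z y : Q → Bool) : ℂ := if ∀ q ∉ ancillae e, y q = z q then 1 else 0

/-- The state of the columns, prepared from zeros next to the state `z` of the other qubits. -/
noncomputable def columnState (θ₀ θ₁ : ℝ) (z y : Q → Bool) : ℂ :=
  away e z y * ∏ j,
    (colVec (colCells e j) (flagQ e j) (tilt (Real.pi / 2))
      (tail₀ ((1 / 2) ^ (Fintype.card ι + 1)) θ₀) y +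
    colVec (colCells e j) (flagQ e j) (tilt 0) (tail₁ ((1 / 2) ^ (Fintype.card ι + 1)) θ₁) y)

/-- The part of `columnState` in which every cell is zero. -/
noncomputable def zeroState (θ₀ : ℝ) (z y : Q → Bool) : ℂ :=
  away e z y * ∏ j, colVec (colCells e j) (flagQ e j) (tilt (Real.pi / 2))
      (tail₀ ((1 / 2) ^ (Fintype.card ι + 1)) θ₀) y

theorem columns_mulVec_ket {θ₀ θ₁ : ℝ}
    (h : Balanced ((1 / 2) ^ (Fintype.card ι + 1)) θ₀ θ₁)
    {z : Q → Bool} (hz : ∀ q ∈ ancillae e, z q = false) :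
    columns e θ₀ θ₁ *ᵥ ket z = columnState e θ₀ θ₁ z := by
  have hket : ket z = away e z * ((univ : Finset J).toList.map fun j =>
      colVec (colCells e j) (flagQ e j) (tilt (Real.pi / 2)) (tilt (Real.pi / 2))).prod := by
    ext y
    have h1 : ∀ b, tilt (Real.pi / 2) b = if b = false then 1 else 0 := by
      intro b
      cases b <;> simp [tilt, -Complex.ofReal_cos, -Complex.ofReal_sin]
    rw [Pi.mul_apply, Finset.prod_map_toList, Finset.prod_apply, away, ket_apply]
    simp only [colVec_zeros_apply, forall_colCells, h1]
    by_cases hy : y = z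
    · subst hy
      rw [forall_ancillae] at hz
      simp [hz.1, hz.2]
    · rw [if_neg hy]
      by_cases hA : ∀ q ∉ ancillae e, y q = z q
      · obtain ⟨q, hq⟩ := Function.ne_iff.1 hy
        have hqA : ¬ ∀ q ∈ ancillae e, y q = false := fun h =>
          hq (by by_cases hm : q ∈ ancillae e; exacts [(h q hm).trans (hz q hm).symm, hA q hm])
        rw [forall_ancillae, not_and_or] at hqA
        symm
        rw [mul_eq_zero, Finset.prod_eq_zero_iff]
        right
        rcases hqA with hqA | hqA
        · push Not at hqA
          obtain ⟨j, r, h⟩ := hqA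
          exact ⟨j, Finset.mem_univ _, if_neg fun h' => h (h' r)⟩
        · push Not at hqA
          obtain ⟨j, h⟩ := hqA
          exact ⟨j, Finset.mem_univ _, by simp [h]⟩
      · rw [if_neg hA, zero_mul]
  have hind : ∀ i j : J, i ≠ j → ∀ u α, IndepOf
      ((insert (flagQ e i) (colCells e i) : Finset Q) : Set Q)
      (colVec (colCells e j) (flagQ e j) u α) := fun i j hij u α =>
    indepOf_colVec (disjoint_columns e hij) u α
  rw [hket, columns, list_prod_mulVec
    (fun j => ((insert (flagQ e j) (colCells e j) : Finset Q) : Set Q)) _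
    (fun j => (realizesOn_column (flagQ_notMem e j) θ₀ θ₁).isLocal) _ _
    (fun j => column_mulVec (flagQ_notMem e j) (colCells_nonempty e j)
      (by rw [card_colCells]; exact h))
    (fun i j hij => hind i j hij _ _) (fun i j hij => (hind i j hij _ _).add (hind i j hij _ _))
    _ (Finset.nodup_toList _)]
  · ext y
    rw [Pi.mul_apply, Finset.prod_map_toList, Finset.prod_apply, columnState]
    simp only [card_colCells, Pi.add_apply]
  · intro j _ y x hyx
    have : ∀ q ∉ ancillae e, y q = x q := fun q hq =>
      hyx q fun hq' => hq (column_subset_ancillae e j hq')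
    rw [away, away]
    refine if_congr (forall₂_congr fun q hq => ?_) rfl rfl
    rw [this q hq]

theorem zeroState_apply (θ₀ : ℝ) (z y : Q → Bool) : zeroState e θ₀ z y =
    if (∀ q ∉ ancillae e, y q = z q) ∧ ∀ j r, y (cellQ e j r) = false then
      ∏ j, tail₀ ((1 / 2) ^ (Fintype.card ι + 1)) θ₀ (y (flagQ e j)) else 0 := by
  rw [zeroState, away]
  simp only [colVec_zeros_apply, forall_colCells, Finset.prod_ite_zero, Finset.mem_univ,
    forall_true_left, ite_and, ite_mul, one_mul, zero_mul]

theorem columnState_eq_zeroState (θ₀ θ₁ : ℝ) {z y : Q → Bool}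
    (h : ∀ j r, y (cellQ e j r) = false) :
    columnState e θ₀ θ₁ z y = zeroState e θ₀ z y := by
  rw [columnState, zeroState]
  congr 1
  refine Finset.prod_congr rfl fun j _ => ?_
  rw [colVec_ones_apply, if_neg, add_zero]
  rw [forall_colCells]
  exact fun h' => Bool.false_ne_true ((h j none).symm.trans (h' none))

/-- On inputs of even parity the signs cancel; on inputs of odd parity they negate the part of the
state whose cells are all zero. -/
theorem rowSign_mul_columnState (θ₀ θ₁ : ℝ) (z y : Q → Bool) :
    rowSign e y * columnState e θ₀ θ₁ z y = columnState e θ₀ θ₁ z y +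
      ((if parityBit (fun i => z (inputQ e i)) = true then -1 else 1) - 1) *
        zeroState e θ₀ z y := by
  by_cases hA : ∀ q ∉ ancillae e, y q = z q
  swap
  · simp [columnState, zeroState, away, hA]
  by_cases h0 : ∀ j r, y (cellQ e j r) = false
  · rw [columnState_eq_zeroState e θ₀ θ₁ h0, ← prod_sign_eq, rowSign]
    have : ∀ i, (if (∀ q ∈ rowCells e i, y q = false) ∧ y (inputQ e i) = true then (-1 : ℂ)
        else 1) = if z (inputQ e i) = true then -1 else 1 := by
      intro i
      have hi : ∀ q ∈ rowCells e i, y q = false := (forall_rowCells e i).2 fun j => h0 j _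
      rw [← hA _ (inputQ_notMem_ancillae e i)]
      simp only [eq_true hi, true_and]
    rw [Finset.prod_congr rfl fun i _ => this i]
    ring
  · have hz : zeroState e θ₀ z y = 0 := by
      rw [zeroState_apply, if_neg fun h => h0 h.2]
    rw [hz, mul_zero, add_zero]
    push Not at h0
    obtain ⟨j, r, hjr⟩ := h0
    by_cases h1 : ∀ r, y (cellQ e j r) = true
    · have : rowSign e y = 1 := Finset.prod_eq_one fun i _ => if_neg fun h => by
        have h2 := (forall_rowCells e i).1 h.1 j
        rw [h1] at h2
        exact Bool.false_ne_true h2.symm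
      rw [this, one_mul]
    · have : columnState e θ₀ θ₁ z y = 0 := by
        rw [columnState, Finset.prod_eq_zero (Finset.mem_univ j), mul_zero]
        rw [colVec_zeros_apply, colVec_ones_apply,
          if_neg fun h => hjr ((forall_colCells e j).1 h r),
          if_neg fun h => h1 ((forall_colCells e j).1 h), add_zero]
      rw [this, mul_zero]

/-- The probability that the cells of all columns are zero. -/
theorem sum_normSq_zeroState {θ₀ θ₁ : ℝ}
    (h : Balanced ((1 / 2) ^ (Fintype.card ι + 1)) θ₀ θ₁)
    {z : Q → Bool} (hz : ∀ q ∈ ancillae e, z q = false) :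
    ∑ y, star (zeroState e θ₀ z y) * zeroState e θ₀ z y =
      (((1 - 8 * ((1 / 2 : ℝ) ^ (Fintype.card ι + 1)) ^ 2 * (1 - Real.cos θ₁)) ^ Fintype.card J : ℝ)
        : ℂ) := by
  set a : ℝ := (1 / 2) ^ (Fintype.card ι + 1)
  have hinj : Function.Injective (flagQ e) := fun i j hij => by simpa [flagQ] using hij
  -- `zeroState` is a product state of single qubits
  have hprod : ∀ y, zeroState e θ₀ z y = ∏ q, if q ∈ univ.image (flagQ e) then
      tail₀ a θ₀ (y q) else if y q = z q then 1 else 0 := by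
    intro y
    rw [zeroState_apply, Finset.prod_ite, Finset.filter_mem_eq_inter, Finset.univ_inter,
      Finset.prod_image fun i _ j _ h => hinj h, Finset.prod_ite_zero, Finset.prod_const_one,
      mul_ite, mul_one, mul_zero]
    have hiff : ((∀ q ∉ ancillae e, y q = z q) ∧ ∀ j r, y (cellQ e j r) = false) ↔
        ∀ q ∈ univ.filter fun q => q ∉ univ.image (flagQ e), y q = z q := by
      refine ⟨fun ⟨h1, h2⟩ q hq => ?_, fun hq => ⟨fun q hqA => ?_, fun j r => ?_⟩⟩
      · by_cases hqA : q ∈ ancillae e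
        · have : ∀ q ∈ ancillae e, q ∉ univ.image (flagQ e) → y q = z q := by
            rw [forall_ancillae]
            refine ⟨fun j r _ => ?_, fun j hj => absurd (Finset.mem_image_of_mem _ (mem_univ j)) hj⟩
            rw [h2, ((forall_ancillae e).1 hz).1]
          exact this q hqA (Finset.mem_filter.1 hq).2
        · exact h1 q hqA
      · refine hq q (Finset.mem_filter.2 ⟨Finset.mem_univ _, fun h => hqA ?_⟩)
        obtain ⟨j, -, rfl⟩ := Finset.mem_image.1 h
        exact Finset.mem_image_of_mem _ (Finset.mem_univ _)
      · rw [hq (cellQ e j r), ((forall_ancillae e).1 hz).1]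
        simp [flagQ, cellQ]
    by_cases hB : ∀ q ∈ univ.filter fun q => q ∉ univ.image (flagQ e), y q = z q
    · rw [if_pos hB, if_pos (hiff.2 hB)]
    · rw [if_neg hB, if_neg (mt hiff.1 hB)]
  simp only [hprod, star_prod, ← Finset.prod_mul_distrib]
  rw [sum_prod_bool fun q b => star (if q ∈ univ.image (flagQ e) then
      tail₀ a θ₀ b else if b = z q then 1 else 0) * (if q ∈ univ.image (flagQ e) then
      tail₀ a θ₀ b else if b = z q then 1 else 0)]
  have hq : ∀ q, ∑ b, star (if q ∈ univ.image (flagQ e) then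
      tail₀ a θ₀ b else if b = z q then 1 else 0) * (if q ∈ univ.image (flagQ e) then
      tail₀ a θ₀ b else if b = z q then 1 else 0) =
      if q ∈ univ.image (flagQ e) then ((1 - 8 * a ^ 2 * (1 - Real.cos θ₁) : ℝ) : ℂ) else 1 := by
    intro q
    split_ifs
    · exact sum_normSq_tail₀ h
    · cases z q <;> simp
  rw [Finset.prod_congr rfl fun q _ => hq q, Finset.prod_ite_mem, Finset.univ_inter,
    Finset.prod_const, Finset.card_image_of_injective _ hinj, Finset.card_univ]
  push_cast
  rfl

/-- Prepare the columns, change signs, and undo the preparation. Since the preparation is undone,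
a state returns to zero ancillae exactly when the signs leave the state of the columns alone. -/
noncomputable def signTest (θ₀ θ₁ : ℝ) : Matrix (Q → Bool) (Q → Bool) ℂ :=
  (columns e θ₀ θ₁)ᴴ * (rowSigns e * columns e θ₀ θ₁)

theorem realizesOn_signTest (θ₀ θ₁ : ℝ) : RealizesOn (Set.range e) 27 (signTest e θ₀ θ₁) := by
  have hA : (ancillae e : Set Q) ⊆ Set.range e := by
    intro q hq
    obtain ⟨a, -, rfl⟩ := Finset.mem_image.1 (Finset.mem_coe.1 hq)
    exact ⟨_, rfl⟩
  have hV := (realizesOn_columns e θ₀ θ₁).mono hA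
  refine hV.conjTranspose.mul (((realizesOn_rowSigns e).mono ?_).mul hV)
  rintro q (⟨i, rfl⟩ | hq)
  exacts [⟨_, rfl⟩, hA hq]

theorem local_signTest (θ₀ θ₁ : ℝ) : Local (ancillae e) (signTest e θ₀ θ₁) := by
  have hV := (realizesOn_columns e θ₀ θ₁).isLocal
  refine hV.conjTranspose.mul (Local.mul ?_ hV)
  intro y x hyx q _
  rw [← mulVec_ket (rowSigns e)] at hyx
  simp only [rowSigns_mulVec, ket_apply] at hyx
  by_contra h
  exact hyx (by rw [if_neg fun h' => h (by rw [h']), mul_zero])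

theorem signTest_mul_self (θ₀ θ₁ : ℝ) : signTest e θ₀ θ₁ * signTest e θ₀ θ₁ = 1 := by
  have hV := (realizesOn_columns e θ₀ θ₁).conjTranspose_mul_self
  have hV' := mul_eq_one_comm.1 hV
  have hZ : rowSigns e * rowSigns e = 1 := matrix_eq_of_mulVec fun ψ => by
    ext y
    simp only [← Matrix.mulVec_mulVec, rowSigns_mulVec, ← mul_assoc, rowSign_mul_self, one_mul,
      Matrix.one_mulVec]
  calc signTest e θ₀ θ₁ * signTest e θ₀ θ₁
      = (columns e θ₀ θ₁)ᴴ * (rowSigns e * ((columns e θ₀ θ₁ * (columns e θ₀ θ₁)ᴴ) *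
        (rowSigns e * columns e θ₀ θ₁))) := by simp only [signTest, Matrix.mul_assoc]
    _ = (columns e θ₀ θ₁)ᴴ * ((rowSigns e * rowSigns e) * columns e θ₀ θ₁) := by
        rw [hV', Matrix.one_mul, Matrix.mul_assoc]
    _ = 1 := by rw [hZ, Matrix.one_mul, hV]

theorem signTest_mulVec_ket {θ₀ θ₁ : ℝ}
    (h : Balanced ((1 / 2) ^ (Fintype.card ι + 1)) θ₀ θ₁)
    {z : Q → Bool} (hz : ∀ q ∈ ancillae e, z q = false) :
    signTest e θ₀ θ₁ *ᵥ ket z = (columns e θ₀ θ₁)ᴴ *ᵥ (columnState e θ₀ θ₁ z +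
      ((if parityBit (fun i => z (inputQ e i)) = true then (-1 : ℂ) else 1) - 1) •
        zeroState e θ₀ z) := by
  rw [signTest, ← Matrix.mulVec_mulVec, ← Matrix.mulVec_mulVec, columns_mulVec_ket e h hz,
    rowSigns_mulVec]
  congr 1
  ext y
  exact rowSign_mul_columnState e θ₀ θ₁ z y

/-- The sign test leaves a state of even parity unchanged. -/
theorem signTest_mulVec_ket_of_even {θ₀ θ₁ : ℝ}
    (h : Balanced ((1 / 2) ^ (Fintype.card ι + 1)) θ₀ θ₁)
    {z : Q → Bool} (hz : ∀ q ∈ ancillae e, z q = false)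
    (hp : parityBit (fun i => z (inputQ e i)) = false) :
    signTest e θ₀ θ₁ *ᵥ ket z = ket z := by
  rw [signTest_mulVec_ket e h hz, hp, ← columns_mulVec_ket e h hz]
  simp [Matrix.mulVec_mulVec, (realizesOn_columns e θ₀ θ₁).conjTranspose_mul_self]

/-- When the columns are all zero with probability `1 / 2`, the sign test takes a state of odd
parity to one orthogonal to all states with zero ancillae. -/
theorem signTest_mulVec_ket_of_odd {θ₀ θ₁ : ℝ}
    (h : Balanced ((1 / 2) ^ (Fintype.card ι + 1)) θ₀ θ₁)
    (hJ : (1 - 8 * ((1 / 2 : ℝ) ^ (Fintype.card ι + 1)) ^ 2 * (1 - Real.cos θ₁)) ^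
      Fintype.card J = 1 / 2)
    {z : Q → Bool} (hz : ∀ q ∈ ancillae e, z q = false)
    (hp : parityBit (fun i => z (inputQ e i)) = true) {y : Q → Bool}
    (hy : ∀ q ∈ ancillae e, y q = false) : (signTest e θ₀ θ₁ *ᵥ ket z) y = 0 := by
  by_cases hyz : y = z
  · subst hyz
    have hV := (realizesOn_columns e θ₀ θ₁).conjTranspose_mul_self
    have hdot : ∀ ψ : (Q → Bool) → ℂ, ((columns e θ₀ θ₁)ᴴ *ᵥ ψ) y =
        ∑ x, star (columnState e θ₀ θ₁ y x) * ψ x := by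
      intro ψ
      rw [Matrix.mulVec, dotProduct]
      refine Finset.sum_congr rfl fun x _ => ?_
      rw [Matrix.conjTranspose_apply, ← mulVec_ket (columns e θ₀ θ₁), columns_mulVec_ket e h hy]
    have h1 : ((columns e θ₀ θ₁)ᴴ *ᵥ columnState e θ₀ θ₁ y) y = 1 := by
      rw [← columns_mulVec_ket e h hy, Matrix.mulVec_mulVec, hV, Matrix.one_mulVec, ket_apply,
        if_pos rfl]
    have h2 : ((columns e θ₀ θ₁)ᴴ *ᵥ zeroState e θ₀ y) y = 1 / 2 := by
      rw [hdot, ← Complex.ofReal_one, ← Complex.ofReal_ofNat, ← Complex.ofReal_div, ← hJ,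
        ← sum_normSq_zeroState e h hy]
      refine Finset.sum_congr rfl fun x _ => ?_
      by_cases hx : zeroState e θ₀ y x = 0
      · rw [hx, mul_zero, mul_zero]
      · rw [columnState_eq_zeroState]
        by_contra hne
        exact hx (by rw [zeroState_apply, if_neg fun h => hne h.2])
    rw [signTest_mulVec_ket e h hy, hp, Matrix.mulVec_add, Matrix.mulVec_smul, Pi.add_apply,
      Pi.smul_apply, h1, h2]
    norm_num
  · by_contra hne
    rw [mulVec_ket] at hne
    refine hyz (funext fun q => ?_)
    by_cases hq : q ∈ ancillae e
    · rw [hy q hq, hz q hq]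
    · exact local_signTest e θ₀ θ₁ y z hne q hq

/-- Flip the target when the sign test leaves all ancillae zero, repeat the test to clean the
ancillae, and flip the target once more: in total it is flipped for odd parity. -/
noncomputable def parityOp (θ₀ θ₁ : ℝ) : Matrix (Q → Bool) (Q → Bool) ℂ :=
  ctrlRefl ∅ (targetQ e) (Real.pi / 2) (Real.pi / 2) * (signTest e θ₀ θ₁ *
    (ctrlRefl (ancillae e) (targetQ e) (Real.pi / 2) (Real.pi / 2) * signTest e θ₀ θ₁))

theorem realizesOn_parityOp (θ₀ θ₁ : ℝ) : RealizesOn (Set.range e) 60 (parityOp e θ₀ θ₁) := by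
  have hE := realizesOn_signTest e θ₀ θ₁
  refine ((realizesOn_ctrlRefl (Finset.notMem_empty _) _ _).mono ?_).mul (hE.mul
    (((realizesOn_ctrlRefl (targetQ_notMem_ancillae e) _ _).mono ?_).mul hE))
  · simp [targetQ]
  · intro q hq
    rcases Finset.mem_insert.1 (Finset.mem_coe.1 hq) with rfl | hq
    · exact ⟨_, rfl⟩
    · obtain ⟨a, -, rfl⟩ := Finset.mem_image.1 hq
      exact ⟨_, rfl⟩

theorem ket_update_not (z : Q → Bool) (t : Q) (y : Q → Bool) :
    ket z (Function.update y t (!y t)) = ket (Function.update z t (!z t)) y := by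
  rw [ket_apply, ket_apply]
  refine if_congr ⟨?_, ?_⟩ rfl rfl <;> rintro rfl <;> simp

theorem parityOp_mulVec_ket {θ₀ θ₁ : ℝ}
    (h : Balanced ((1 / 2) ^ (Fintype.card ι + 1)) θ₀ θ₁)
    (hJ : (1 - 8 * ((1 / 2 : ℝ) ^ (Fintype.card ι + 1)) ^ 2 * (1 - Real.cos θ₁)) ^
      Fintype.card J = 1 / 2)
    {z : Q → Bool} (hz : ∀ q ∈ ancillae e, z q = false) :
    parityOp e θ₀ θ₁ *ᵥ ket z = ket (Function.update z (targetQ e)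
      (xor (z (targetQ e)) (parityBit fun i => z (inputQ e i)))) := by
  set t := targetQ e with ht
  have htA : t ∉ ancillae e := targetQ_notMem_ancillae e
  have hflip : ∀ x : Q → Bool, ctrlRefl ∅ t (Real.pi / 2) (Real.pi / 2) *ᵥ ket x =
      ket (Function.update x t (!x t)) := by
    intro x
    ext y
    rw [ctrlRefl_flip_mulVec (Finset.notMem_empty _), if_pos (by simp), ket_update_not]
  have hupd : ∀ (x : Q → Bool) b, (∀ q ∈ ancillae e, Function.update x t b q = false) ↔
      ∀ q ∈ ancillae e, x q = false := fun x b => forall₂_congr fun q hq => by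
    rw [Function.update_of_ne fun h' : q = t => htA (h' ▸ hq)]
  simp only [parityOp, ← Matrix.mulVec_mulVec]
  cases hp : parityBit fun i => z (inputQ e i)
  · have hT : ctrlRefl (ancillae e) t (Real.pi / 2) (Real.pi / 2) *ᵥ ket z =
        ket (Function.update z t (!z t)) := by
      ext y
      rw [ctrlRefl_flip_mulVec htA]
      split_ifs with hy
      · exact ket_update_not z t y
      · rw [ket_apply, ket_apply, if_neg, if_neg] <;> rintro rfl
        exacts [hy ((hupd _ _).2 hz), hy hz]
    have hp' : parityBit (fun i => Function.update z t (!z t) (inputQ e i)) = false := by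
      rw [← hp]
      congr 1
      funext i
      exact Function.update_of_ne (by simp [ht, inputQ, targetQ]) _ _
    rw [signTest_mulVec_ket_of_even e h hz hp, hT,
      signTest_mulVec_ket_of_even e h ((hupd _ _).2 hz) hp', hflip]
    simp
  · have hT : ctrlRefl (ancillae e) t (Real.pi / 2) (Real.pi / 2) *ᵥ
        (signTest e θ₀ θ₁ *ᵥ ket z) = signTest e θ₀ θ₁ *ᵥ ket z := by
      ext y
      rw [ctrlRefl_flip_mulVec htA]
      split_ifs with hy
      · rw [signTest_mulVec_ket_of_odd e h hJ hz hp hy,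
          signTest_mulVec_ket_of_odd e h hJ hz hp ((hupd _ _).2 hy)]
      · rfl
    rw [hT, Matrix.mulVec_mulVec (ket z) (signTest e θ₀ θ₁), signTest_mul_self, Matrix.one_mulVec,
      hflip]
    simp

end Gadget

/-! ### Trees of parities -/

/-- The parity of the bits indexed by `ι` is computed exactly, with clean ancillae, in depth `D`
with at most `N` ancillae. The circuit is available for every injective placement `e` of the
inputs, the target and the ancillae in a register, and acts on these qubits only. -/
def HasParity (ι : Type) [Fintype ι] (D N : ℕ) : Prop :=
  ∃ (A : Type) (_ : Fintype A), Fintype.card A ≤ N ∧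
    ∀ (Q : Type) [Fintype Q] [DecidableEq Q] (e : (ι ⊕ Unit) ⊕ A ↪ Q),
      ∃ M, RealizesOn (Set.range e) D M ∧ ∀ z : Q → Bool, (∀ a, z (e (Sum.inr a)) = false) →
        M *ᵥ ket z = ket (Function.update z (e (Sum.inl (Sum.inr ())))
          (xor (z (e (Sum.inl (Sum.inr ())))) (parityBit fun i => z (e (Sum.inl (Sum.inl i))))))

/-- Parity of any number of bits is computed exactly in constant depth with exponentially many
ancillae. -/
theorem hasParity_base (ι : Type) [Fintype ι] [Nonempty ι] :
    HasParity ι 60 (4 ^ (Fintype.card ι + 1) * (Fintype.card ι + 2)) := by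
  obtain ⟨θ₀, θ₁, h, hJ⟩ := exists_angles (n := Fintype.card ι + 1)
    (Nat.succ_le_succ Fintype.card_pos)
  -- one row per input and a spare one, since the angles need at least two rows
  refine ⟨Fin (4 ^ (Fintype.card ι + 1)) × Option (Option ι), inferInstance, by simp,
    fun Q _ _ e => ⟨parityOp e θ₀ θ₁, realizesOn_parityOp e θ₀ θ₁, fun z hz => ?_⟩⟩
  exact parityOp_mulVec_ket e h (by rw [Fintype.card_fin]; exact hJ)
    fun q hq => by
      obtain ⟨a, -, rfl⟩ := Finset.mem_image.1 hq
      exact hz a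

theorem bool_eq_of_sign_eq {b c : Bool}
    (h : (if b = true then (-1 : ℂ) else 1) = if c = true then -1 else 1) : b = c := by
  cases b <;> cases c <;> first | rfl | (norm_num at h)

theorem parityBit_comp_equiv {ι κ : Type} [Fintype ι] [Fintype κ] (σ : ι ≃ κ) (b : κ → Bool) :
    parityBit (fun i => b (σ i)) = parityBit b := by
  refine bool_eq_of_sign_eq ?_
  rw [← prod_sign_eq, ← prod_sign_eq]
  exact Equiv.prod_comp σ fun k => if b k = true then (-1 : ℂ) else 1

theorem parityBit_prod {ι κ : Type} [Fintype ι] [Fintype κ] (b : κ × ι → Bool) :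
    parityBit (fun i => parityBit fun k => b (k, i)) = parityBit b := by
  refine bool_eq_of_sign_eq ?_
  rw [← prod_sign_eq, ← prod_sign_eq, Fintype.prod_prod_type_right]
  exact Finset.prod_congr rfl fun i _ => (prod_sign_eq _).symm

theorem HasParity.congr {ι κ : Type} [Fintype ι] [Fintype κ] {D N : ℕ} (h : HasParity ι D N)
    (σ : ι ≃ κ) : HasParity κ D N := by
  obtain ⟨A, _, hA, h⟩ := h
  refine ⟨A, inferInstance, hA, fun Q _ _ e => ?_⟩
  obtain ⟨M, hM, hz⟩ := h Q
    ((Equiv.sumCongr (Equiv.sumCongr σ (Equiv.refl Unit)) (Equiv.refl A)).toEmbedding.trans e)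
  refine ⟨M, hM.mono ?_, fun z hz0 => ?_⟩
  · rintro _ ⟨q, rfl⟩
    exact ⟨_, rfl⟩
  · rw [hz z hz0, ← parityBit_comp_equiv σ]
    rfl

/-- The basis state `z` after the bits `p i z` have been added to the qubits `s i`, `i ∈ l`. -/
def addBits {ι Q : Type} [DecidableEq ι] [DecidableEq Q] (s : ι → Q)
    (p : ι → (Q → Bool) → Bool) (l : List ι) (z : Q → Bool) (q : Q) : Bool :=
  xor (z q) (decide (∃ i ∈ l, q = s i ∧ p i z = true))

/-- Parities of blocks are written to fresh ancillae in parallel, added up, and erased again. -/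
theorem HasParity.prod {κ ι : Type} [Fintype κ] [Fintype ι] {D₁ D₂ N₁ N₂ : ℕ}
    (h₁ : HasParity κ D₁ N₁) (h₂ : HasParity ι D₂ N₂) :
    HasParity (κ × ι) (D₁ + (D₂ + D₁)) (Fintype.card ι * (N₁ + 1) + N₂) := by
  classical
  obtain ⟨A₁, _, hA₁, h₁⟩ := h₁
  obtain ⟨A₂, _, hA₂, h₂⟩ := h₂
  refine ⟨(ι × Option A₁) ⊕ A₂, inferInstance, ?_, fun Q _ _ e => ?_⟩
  · rw [Fintype.card_sum, Fintype.card_prod, Fintype.card_option]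
    gcongr
  let x : κ → ι → Q := fun k i => e (Sum.inl (Sum.inl (k, i)))
  let t : Q := e (Sum.inl (Sum.inr ()))
  let s : ι → Q := fun i => e (Sum.inr (Sum.inl (i, none)))
  let a₁ : ι → A₁ → Q := fun i a => e (Sum.inr (Sum.inl (i, some a)))
  let a₂ : A₂ → Q := fun a => e (Sum.inr (Sum.inr a))
  let e₁ : ι → (κ ⊕ Unit) ⊕ A₁ ↪ Q := fun i =>
    ⟨Sum.elim (Sum.elim (fun k => x k i) fun _ => s i) (a₁ i), by
      rintro ((k | _) | a) ((k' | _) | a') h <;> simp [x, s, a₁] at h ⊢ <;> exact h⟩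
  let e₂ : (ι ⊕ Unit) ⊕ A₂ ↪ Q :=
    ⟨Sum.elim (Sum.elim s fun _ => t) a₂, by
      rintro ((k | _) | a) ((k' | _) | a') h <;> simp [t, s, a₂] at h ⊢ <;> exact h⟩
  choose M₁ hM₁ hz₁ using fun i => h₁ Q (e₁ i)
  obtain ⟨M₂, hM₂, hz₂⟩ := h₂ Q e₂
  let B := ((univ : Finset ι).toList.map M₁).prod
  have hB : RealizesOn (Set.range e) D₁ B := by
    refine (RealizesOn.par_list _ (fun i => Set.range (e₁ i)) M₁ ?_ fun i _ => hM₁ i).mono ?_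
    · refine (Finset.nodup_toList _).imp fun {i j} hij => Set.disjoint_left.2 ?_
      rintro _ ⟨u, rfl⟩ ⟨v, hv⟩
      change Sum.elim (Sum.elim (fun k => x k j) fun _ => s j) (a₁ j) v =
        Sum.elim (Sum.elim (fun k => x k i) fun _ => s i) (a₁ i) u at hv
      rcases u with (k | _) | a <;> rcases v with (k' | _) | a' <;> simp [x, s, a₁] at hv <;>
        exact hij (by first | exact hv.2.symm | exact hv.1.symm | exact hv.symm)
    · rintro q ⟨i, -, (k | _) | a, rfl⟩ <;> exact ⟨_, rfl⟩
  have hM₂' : RealizesOn (Set.range e) D₂ M₂ := by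
    refine hM₂.mono ?_
    rintro q ⟨(k | _) | a, rfl⟩ <;> exact ⟨_, rfl⟩
  let p : ι → (Q → Bool) → Bool := fun i z => parityBit fun k => z (x k i)
  have hxs : ∀ k i j, x k i ≠ s j := by intro k i j; simp [x, s]
  have has : ∀ i a j, a₁ i a ≠ s j := by intro i a j; simp [a₁, s]
  have ha2s : ∀ a j, a₂ a ≠ s j := by intro a j; simp [a₂, s]
  have hts : ∀ j, t ≠ s j := by intro j; simp [t, s]
  have hs : ∀ i j, s i = s j ↔ i = j := by intro i j; simp [s]
  have hne : ∀ l z q, (∀ j, q ≠ s j) → addBits s p l z q = z q := by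
    intro l z q hq
    simp [addBits, hq]
  have hBl : ∀ l : List ι, l.Nodup → ∀ z : Q → Bool, (∀ i a, z (a₁ i a) = false) →
      (l.map M₁).prod *ᵥ ket z = ket (addBits s p l z) := by
    intro l hl z hz
    induction l with
    | nil =>
      have : addBits s p [] z = z := by funext q; simp [addBits]
      simp [this]
    | cons i l ih =>
      rw [List.nodup_cons] at hl
      have hi := hz₁ i (addBits s p l z) fun a => by
        change addBits s p l z (a₁ i a) = false
        rw [hne _ _ _ (has i a), hz]
      rw [List.map_cons, List.prod_cons, ← Matrix.mulVec_mulVec, ih hl.2, hi]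
      congr 1
      change Function.update (addBits s p l z) (s i) (xor (addBits s p l z (s i))
        (parityBit fun k => addBits s p l z (x k i))) = _
      have hp : (parityBit fun k => addBits s p l z (x k i)) = p i z := by
        simp only [hne _ _ _ (hxs _ i)]
        rfl
      rw [hp]
      funext q
      by_cases hq : q = s i
      · subst hq
        rw [Function.update_self]
        simp [addBits, hs, hl.1]
      · rw [Function.update_of_ne hq]
        simp [addBits, hq]
  have hB' : ∀ z : Q → Bool, (∀ i a, z (a₁ i a) = false) →
      B *ᵥ ket z = ket (addBits s p univ.toList z) := hBl _ (Finset.nodup_toList _)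
  have hadd : ∀ z i, addBits s p univ.toList z (s i) = xor (z (s i)) (p i z) := by
    intro z i
    simp [addBits, hs]
  refine ⟨B * (M₂ * B), hB.mul (hM₂'.mul hB), fun z hz => ?_⟩
  set z₁ := addBits s p univ.toList z with hz₁def
  have hz1 : ∀ i a, z (a₁ i a) = false := fun i a => hz _
  have hzs : ∀ i, z (s i) = false := fun i => hz _
  have hpar : (parityBit fun i => z₁ (s i)) =
      parityBit fun ki : κ × ι => z (e (Sum.inl (Sum.inl ki))) := by
    rw [← parityBit_prod]
    congr 1
    funext i
    rw [hz₁def, hadd, hzs, Bool.false_xor]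
  have h2 := hz₂ z₁ fun a => by
    change z₁ (a₂ a) = false
    rw [hz₁def, hne _ _ _ (ha2s a)]
    exact hz _
  rw [← Matrix.mulVec_mulVec, ← Matrix.mulVec_mulVec, hB' z hz1, h2]
  change B *ᵥ ket (Function.update z₁ t (xor (z₁ t) (parityBit fun i => z₁ (s i)))) =
    ket (Function.update z t (xor (z t) _))
  rw [hpar, hz₁def, hne _ _ _ hts, ← hz₁def]
  set c := xor (z t) (parityBit fun ki : κ × ι => z (e (Sum.inl (Sum.inl ki))))
  have hat : ∀ i a, a₁ i a ≠ t := by intro i a; simp [a₁, t]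
  have hxt : ∀ k i, x k i ≠ t := by intro k i; simp [x, t]
  rw [hB' _ fun i a => by rw [Function.update_of_ne (hat i a), hz₁def, hne _ _ _ (has i a), hz1]]
  congr 1
  funext q
  by_cases hq : ∃ i, q = s i
  · obtain ⟨i, rfl⟩ := hq
    have hp : p i (Function.update z₁ t c) = p i z := by
      simp only [p, Function.update_of_ne (hxt _ i), hz₁def, hne _ _ _ (hxs _ i)]
    rw [hadd, hp, Function.update_of_ne (hts i).symm, Function.update_of_ne (hts i).symm, hz₁def,
      hadd]
    simp
  · rw [hne _ _ _ fun j h => hq ⟨j, h⟩]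
    by_cases hqt : q = t
    · subst hqt
      rw [Function.update_self, Function.update_self]
    · rw [Function.update_of_ne hqt, Function.update_of_ne hqt, hz₁def,
        hne _ _ _ fun j h => hq ⟨j, h⟩]

/-- Parity of `w ^ d` bits by a tree of fan-in `w` and height `d`. -/
theorem hasParity_pow {w D N : ℕ} (h : HasParity (Fin w) D N) {D₀ N₀ : ℕ}
    (h₀ : HasParity (Fin 1) D₀ N₀) (d : ℕ) : HasParity (Fin (w ^ d)) (2 * D * d + D₀)
      ((∑ k ∈ range d, w ^ k) * (N + 1) + N₀) := by
  induction d with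
  | zero => simpa using h₀.congr (finCongr (pow_zero w).symm)
  | succ d ih =>
    have := (h.prod ih).congr
      (finProdFinEquiv.trans (finCongr (pow_succ' w d).symm))
    convert this using 1
    · ring
    · rw [Finset.sum_range_succ, Fintype.card_fin]
      ring

/-! ### From clean computation to approximate implementation -/

/-- The isometry that adjoins `a` zero qubits. -/
def adjoinZeros (n a : ℕ) : Matrix (Fin n ⊕ Fin a → Bool) (Fin n → Bool) ℂ :=
  Matrix.of fun z x => if z = Sum.elim x (fun _ => false) then 1 else 0

theorem eq_elim_false_iff {n a : ℕ} (z : Fin n ⊕ Fin a → Bool) (x : Fin n → Bool) :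
    z = Sum.elim x (fun _ => false) ↔
      (∀ j, z (Sum.inr j) = false) ∧ x = fun i => z (Sum.inl i) := by
  constructor
  · rintro rfl
    simp
  · rintro ⟨h, rfl⟩
    funext q
    cases q <;> simp [h]

theorem adjoinZeros_mul_apply {n a : ℕ} (U : Matrix (Fin n → Bool) (Fin n → Bool) ℂ)
    (z : Fin n ⊕ Fin a → Bool) (x : Fin n → Bool) : (adjoinZeros n a * U) z x =
      if ∀ j, z (Sum.inr j) = false then U (fun i => z (Sum.inl i)) x else 0 := by
  simp only [Matrix.mul_apply, adjoinZeros, Matrix.of_apply, eq_elim_false_iff, ite_and, ite_mul,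
    one_mul, zero_mul]
  split_ifs <;> simp

theorem withZeros_eq {n a : ℕ} (ψ : (Fin n → Bool) → ℂ) :
    withZeros a ψ = adjoinZeros n a *ᵥ ψ := by
  ext z
  simp only [Matrix.mulVec, dotProduct, adjoinZeros, Matrix.of_apply, eq_elim_false_iff, ite_and,
    ite_mul, one_mul, zero_mul, withZeros]
  split_ifs <;> simp

theorem mul_adjoinZeros_apply {n a : ℕ}
    (M : Matrix (Fin n ⊕ Fin a → Bool) (Fin n ⊕ Fin a → Bool) ℂ)
    (z : Fin n ⊕ Fin a → Bool) (x : Fin n → Bool) :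
    (M * adjoinZeros n a) z x = M z (Sum.elim x fun _ => false) := by
  simp [Matrix.mul_apply, adjoinZeros]

theorem adjoinZeros_conjTranspose_mul_self (n a : ℕ) :
    (adjoinZeros n a)ᴴ * adjoinZeros n a = 1 := by
  ext x y
  simp only [Matrix.mul_apply, Matrix.conjTranspose_apply, adjoinZeros, Matrix.of_apply,
    Matrix.one_apply]
  have h : ∀ z : Fin n ⊕ Fin a → Bool,
      star (if z = Sum.elim x (fun _ => false) then (1 : ℂ) else 0) =
      if z = Sum.elim x (fun _ => false) then 1 else 0 := fun z => by split_ifs <;> simp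
  simp only [h, ite_mul, one_mul, zero_mul, Finset.sum_ite_eq', Finset.mem_univ,
    if_true]
  refine if_congr ⟨fun h => ?_, fun h => by rw [h]⟩ rfl rfl
  exact funext fun i => congrFun h (Sum.inl i)

/-- A circuit that performs `U` exactly and returns the ancillae to zero implements `U` with any
error bound. -/
theorem epsImplements_of_mul_adjoinZeros {n a : ℕ} {C : Circuit (Fin n ⊕ Fin a)}
    {U : Matrix (Fin n → Bool) (Fin n → Bool) ℂ}
    (h : C.toMatrix * adjoinZeros n a = adjoinZeros n a * U)
    (hC : (C.toMatrix)ᴴ * C.toMatrix = 1) {ε : ℝ} (hε : 0 ≤ ε) : EpsImplements C U ε := by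
  intro ψ hψ
  have e : star (withZeros a ψ) ⬝ᵥ ((C.toMatrix)ᴴ *ᵥ withZeros a (U *ᵥ ψ)) = 1 := by
    rw [withZeros_eq, withZeros_eq, Matrix.mulVec_mulVec _ (adjoinZeros n a) U, ← h,
      Matrix.mulVec_mulVec, ← Matrix.mul_assoc, hC, Matrix.one_mul, Matrix.star_mulVec,
      ← Matrix.dotProduct_mulVec, Matrix.mulVec_mulVec, adjoinZeros_conjTranspose_mul_self,
      Matrix.one_mulVec, dotProduct]
    have : ∀ x, star ψ x * ψ x = ((‖ψ x‖ ^ 2 : ℝ) : ℂ) := fun x => by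
      rw [Complex.ofReal_pow]
      exact Complex.conj_mul' (ψ x)
    rw [Finset.sum_congr rfl fun x _ => this x, ← Complex.ofReal_sum, hψ, Complex.ofReal_one]
  rw [e]
  simp [hε]

/-- The qubit `τ (inr ())` receives the parity of the qubits `τ (inl i)`. -/
def parityMap {k : ℕ} (τ : Fin k ⊕ Unit ↪ Fin (k + 1)) (x : Fin (k + 1) → Bool) :
    Fin (k + 1) → Bool :=
  Function.update x (τ (Sum.inr ()))
    (xor (x (τ (Sum.inr ()))) (parityBit fun i => x (τ (Sum.inl i))))

theorem HasParity.exists_realizesOn {k D N : ℕ} (h : HasParity (Fin k) D N)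
    (τ : Fin k ⊕ Unit ↪ Fin (k + 1)) : ∃ a ≤ N, ∃ M,
      RealizesOn (Q := Fin (k + 1) ⊕ Fin a) Set.univ D M ∧
      M * adjoinZeros (k + 1) a = adjoinZeros (k + 1) a * basisMap (parityMap τ) := by
  obtain ⟨A, _, hA, h⟩ := h
  obtain ⟨M, hM, hz⟩ := h (Fin (k + 1) ⊕ Fin (Fintype.card A))
    (Function.Embedding.sumMap τ (Fintype.equivFin A).toEmbedding)
  refine ⟨_, hA, M, hM.mono (Set.subset_univ _), ?_⟩
  ext z x
  rw [mul_adjoinZeros_apply, ← mulVec_ket M, hz _ fun a => rfl, adjoinZeros_mul_apply, ket_apply]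
  have e : Function.update (Sum.elim x fun _ : Fin (Fintype.card A) => false)
      (Sum.inl (τ (Sum.inr ()))) (xor (x (τ (Sum.inr ())))
        (parityBit fun i => x (τ (Sum.inl i)))) = Sum.elim (parityMap τ x) fun _ => false :=
    Sum.update_elim_inl
  change (if z = Function.update (Sum.elim x fun _ : Fin (Fintype.card A) => false)
      (Sum.inl (τ (Sum.inr ()))) (xor (x (τ (Sum.inr ())))
        (parityBit fun i => x (τ (Sum.inl i)))) then (1 : ℂ) else 0) = _
  rw [e]
  simp only [eq_elim_false_iff, ite_and, basisMap, Matrix.of_apply, eq_comm]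

/-- The wires of PARITY: the last qubit is the target. -/
def parityWires (k : ℕ) : Fin k ⊕ Unit ↪ Fin (k + 1) :=
  ⟨Sum.elim Fin.castSucc fun _ => Fin.last k, by
    rintro (i | _) (j | _) h <;> simp [Fin.castSucc_ne_last, (Fin.castSucc_ne_last _).symm] at h ⊢
    exact h⟩

/-- The wires of FANOUT: in the Hadamard basis qubit `0` is the target of a parity. -/
def fanoutWires (k : ℕ) : Fin k ⊕ Unit ↪ Fin (k + 1) :=
  ⟨Sum.elim Fin.succ fun _ => 0, by
    rintro (i | _) (j | _) h <;> simp [Fin.succ_ne_zero, (Fin.succ_ne_zero _).symm] at h ⊢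
    exact h⟩

theorem HasParity.exists_parity {k D N : ℕ} (h : HasParity (Fin k) D N) :
    ∃ a ≤ N, ∃ C : Circuit (Fin (k + 1) ⊕ Fin a), C.depth = D ∧
      ∀ ε : ℝ, 0 ≤ ε → EpsImplements C (parityGate k) ε := by
  obtain ⟨a, ha, M, hM, h⟩ := h.exists_realizesOn (parityWires k)
  have hu := hM.conjTranspose_mul_self
  obtain ⟨C, hC, -, rfl⟩ := hM
  exact ⟨a, ha, C, hC, fun ε hε => epsImplements_of_mul_adjoinZeros h hu hε⟩

/-! ### Fanout -/

/-- The Hadamard matrix. -/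
noncomputable def hadamardMatrix : Matrix Bool Bool ℂ :=
  Matrix.of fun a b => ((Real.sqrt 2 / 2 : ℝ) : ℂ) * if a = true ∧ b = true then -1 else 1

theorem hadamardMatrix_conjTranspose : hadamardMatrixᴴ = hadamardMatrix := by
  ext a b
  cases a <;> cases b <;> simp [hadamardMatrix, Matrix.conjTranspose_apply]

theorem hadamardMatrix_mul_self : hadamardMatrix * hadamardMatrix = 1 := by
  have h : ((Real.sqrt 2 / 2 : ℝ) : ℂ) * ((Real.sqrt 2 / 2 : ℝ) : ℂ) = 1 / 2 := by
    rw [← Complex.ofReal_mul, div_mul_div_comm, Real.mul_self_sqrt (by norm_num)]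
    norm_num
  ext a b
  cases a <;> cases b <;> simp only [hadamardMatrix, Matrix.mul_apply, Matrix.of_apply,
    Fintype.sum_bool, Matrix.one_apply] <;> simp [-Complex.ofReal_div, h] <;> norm_num

/-- The Hadamard gate. -/
noncomputable def hadamard : Matrix.unitaryGroup Bool ℂ :=
  ⟨hadamardMatrix, Matrix.mem_unitaryGroup_iff.2 (by
    rw [Matrix.star_eq_conjTranspose, hadamardMatrix_conjTranspose, hadamardMatrix_mul_self])⟩

/-- Hadamard gates on all `n` qubits. -/
noncomputable def hadamards (n : ℕ) : Matrix (Fin n → Bool) (Fin n → Bool) ℂ :=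
  tens fun _ => hadamardMatrix

theorem hadamards_mul_self (n : ℕ) : hadamards n * hadamards n = 1 := by
  rw [hadamards, tens_mul, hadamardMatrix_mul_self, tens_one]

/-- The sign `(-1) ^ (x ⬝ y)` by which Hadamard gates on all qubits couple `x` and `y`, up to
normalization. -/
theorem hadamards_apply (n : ℕ) (x y : Fin n → Bool) :
    hadamards n x y = ((Real.sqrt 2 / 2 : ℝ) : ℂ) ^ n *
      ∏ i, if x i = true ∧ y i = true then -1 else 1 := by
  simp only [hadamards, tens_apply, hadamardMatrix, Matrix.of_apply, Finset.prod_mul_distrib,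
    Finset.prod_const, Finset.card_univ, Fintype.card_fin]

theorem fanout_involutive (k : ℕ) : Function.Involutive
    fun (x : Fin (k + 1) → Bool) i => if i = 0 then x 0 else xor (x 0) (x i) := by
  intro x
  funext i
  by_cases h : i = 0
  · simp [h]
  · simp [h]

/-- Conjugation by Hadamard gates turns the parity with target `0` into a fanout from `0`. -/
theorem fanoutGate_mul_hadamard (k : ℕ) :
    fanoutGate k * hadamards (k + 1) =
      hadamards (k + 1) * basisMap (parityMap (fanoutWires k)) := by
  ext x y
  have h1 : (fanoutGate k * hadamards (k + 1)) x y =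
      hadamards (k + 1) (fun i => if i = 0 then x 0 else xor (x 0) (x i)) y := by
    rw [← mulVec_ket (_ * _), ← Matrix.mulVec_mulVec, fanoutGate,
      basisMap_mulVec_of_involutive (fanout_involutive k), Function.comp_apply, mulVec_ket]
  have h2 : (hadamards (k + 1) * basisMap (parityMap (fanoutWires k))) x y =
      hadamards (k + 1) x (parityMap (fanoutWires k) y) := by
    simp [Matrix.mul_apply, basisMap]
  have h3 : parityMap (fanoutWires k) y 0 = xor (y 0) (parityBit fun i : Fin k => y i.succ) :=
    Function.update_self ..
  have h4 : ∀ i : Fin k, parityMap (fanoutWires k) y i.succ = y i.succ := fun i =>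
    Function.update_of_ne (Fin.succ_ne_zero i) _ _
  have h5 := prod_sign_eq fun i : Fin k => y i.succ
  rw [h1, h2, hadamards_apply, hadamards_apply, Fin.prod_univ_succ, Fin.prod_univ_succ]
  congr 1
  simp only [if_true, Fin.succ_ne_zero, if_false, h3, h4]
  cases hx : x 0
  · simp
  · have h6 : ∀ i : Fin k,
        (if (xor true (x i.succ)) = true ∧ y i.succ = true then (-1 : ℂ) else 1) =
        (if y i.succ = true then -1 else 1) *
          if x i.succ = true ∧ y i.succ = true then -1 else 1 := by
      intro i
      cases x i.succ <;> cases y i.succ <;> simp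
    rw [Finset.prod_congr rfl fun i _ => h6 i, Finset.prod_mul_distrib, h5]
    cases y 0 <;> cases parityBit fun i : Fin k => y i.succ <;> simp

theorem HasParity.exists_fanout {k D N : ℕ} (h : HasParity (Fin k) D N) :
    ∃ a ≤ N, ∃ C : Circuit (Fin (k + 1) ⊕ Fin a), C.depth = D + 2 ∧
      ∀ ε : ℝ, 0 ≤ ε → EpsImplements C (fanoutGate k) ε := by
  obtain ⟨a, ha, M, hM, h⟩ := h.exists_realizesOn (fanoutWires k)
  have hH := (realizesOn_tens (Q := Fin (k + 1) ⊕ Fin a) (univ.map Function.Embedding.inl)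
    fun _ => hadamard).mono (Set.subset_univ _)
  set H := tens fun q : Fin (k + 1) ⊕ Fin a =>
    if q ∈ univ.map Function.Embedding.inl then hadamard.1 else 1 with hHdef
  have hHJ : H * adjoinZeros (k + 1) a =
      adjoinZeros (k + 1) a * hadamards (k + 1) := by
    ext z x
    rw [mul_adjoinZeros_apply, adjoinZeros_mul_apply, hHdef, hadamards, tens_apply, tens_apply,
      Fintype.prod_sum_type]
    simp only [Finset.mem_map, Finset.mem_univ, true_and, Function.Embedding.inl_apply,
      Sum.inl.injEq, exists_eq, if_true, reduceCtorEq, exists_false, if_false, Sum.elim_inl,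
      Sum.elim_inr, Matrix.one_apply, Finset.prod_ite_zero, Finset.prod_const_one, forall_true_left,
      mul_ite, mul_one, mul_zero]
    rfl
  have hF : H * (M * H) * adjoinZeros (k + 1) a = adjoinZeros (k + 1) a * fanoutGate k := by
    rw [Matrix.mul_assoc, Matrix.mul_assoc, hHJ, ← Matrix.mul_assoc M, h, Matrix.mul_assoc,
      ← Matrix.mul_assoc H, hHJ, Matrix.mul_assoc, ← Matrix.mul_assoc (hadamards _) (basisMap _),
      ← fanoutGate_mul_hadamard, Matrix.mul_assoc, hadamards_mul_self, Matrix.mul_one]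
  have hM' := hH.mul (hM.mul hH)
  have hu := hM'.conjTranspose_mul_self
  obtain ⟨C, hC, -, hCM⟩ := hM'
  refine ⟨a, ha, C, by rw [hC]; ring, fun ε hε => epsImplements_of_mul_adjoinZeros ?_ ?_ hε⟩
  · rw [hCM, hF]
  · rw [hCM, hu]

/-! ### Counting ancillae -/

theorem ancilla_count_le {w : ℕ} (hw : 1 ≤ w) :
    2 * (4 ^ (w + 1) * (w + 2) + 1) ≤ 2 ^ (8 * w) := by
  have h1 : w + 2 ≤ 2 ^ (w + 1) := Nat.lt_two_pow_self (n := w + 1)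
  have h2 : 4 ^ (w + 1) * (w + 2) ≤ 2 ^ (3 * w + 3) := by
    calc 4 ^ (w + 1) * (w + 2) ≤ 4 ^ (w + 1) * 2 ^ (w + 1) := Nat.mul_le_mul_left _ h1
      _ = 2 ^ (3 * w + 3) := by
        rw [← Nat.mul_pow, show 4 * 2 = 2 ^ 3 from rfl, ← pow_mul]
        congr 1
  have h3 : 1 ≤ 2 ^ (3 * w + 3) := Nat.one_le_two_pow
  calc 2 * (4 ^ (w + 1) * (w + 2) + 1) ≤ 2 ^ 2 * 2 ^ (3 * w + 3) := by omega
    _ = 2 ^ (3 * w + 5) := by rw [← pow_add]; congr 1; ring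
    _ ≤ 2 ^ (8 * w) := Nat.pow_le_pow_right (by norm_num) (by omega)

theorem tree_ancilla_count_le {d w : ℕ} (hd : 1 ≤ d) (hw : 1 ≤ w) :
    (∑ k ∈ range d, w ^ k) * (4 ^ (w + 1) * (w + 2) + 1) + 48 ≤ d * w ^ d * 2 ^ (8 * w) := by
  set N := 4 ^ (w + 1) * (w + 2) with hN
  have h48 : 48 ≤ N := by
    calc 48 = 4 ^ 2 * 3 := rfl
      _ ≤ N := Nat.mul_le_mul (Nat.pow_le_pow_right (by norm_num) (by omega)) (by omega)
  have hsum : ∑ k ∈ range d, w ^ k ≤ d * w ^ d := by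
    calc ∑ k ∈ range d, w ^ k ≤ ∑ _k ∈ range d, w ^ d :=
          Finset.sum_le_sum fun k hk => Nat.pow_le_pow_right hw (Finset.mem_range.1 hk).le
      _ = d * w ^ d := by simp
  have h1 : 1 ≤ d * w ^ d := Nat.mul_pos hd (Nat.pow_pos hw)
  calc (∑ k ∈ range d, w ^ k) * (N + 1) + 48 ≤ d * w ^ d * (N + 1) + d * w ^ d * (N + 1) :=
        Nat.add_le_add (Nat.mul_le_mul_right _ hsum) (by nlinarith)
    _ = d * w ^ d * (2 * (N + 1)) := by ring
    _ ≤ d * w ^ d * 2 ^ (8 * w) := Nat.mul_le_mul_left _ (ancilla_count_le hw)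

end QAC

theorem mainTheorem9 :
    ∃ c A K : ℝ, 0 < c ∧ 0 < A ∧ 0 < K ∧ ∀ d w : ℕ, 1 ≤ d → 1 ≤ w →
      (∃ (a : ℕ) (C : QAC.Circuit (Fin (w + 1) ⊕ Fin a)),
        (C.depth : ℝ) ≤ K * Real.logb 2 ((d : ℝ) + 1) ∧
        (a : ℝ) ≤ (d : ℝ) * (2 : ℝ) ^ (A * (w : ℝ)) ∧
        QAC.EpsImplements C (QAC.parityGate w) (1 / (2 : ℝ) ^ (c * (d : ℝ) * (w : ℝ)))) ∧
      (∃ (a : ℕ) (C : QAC.Circuit (Fin (w ^ d + 1) ⊕ Fin a)),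
        (C.depth : ℝ) ≤ K * ((d : ℝ) * Real.logb 2 ((d : ℝ) + 1)) ∧
        (a : ℝ) ≤ (d : ℝ) * (w : ℝ) ^ d * (2 : ℝ) ^ (A * (w : ℝ)) ∧
        QAC.EpsImplements C (QAC.parityGate (w ^ d))
          ((w : ℝ) ^ d / (2 : ℝ) ^ (c * (d : ℝ) * (w : ℝ)))) ∧
      (∃ (a : ℕ) (C : QAC.Circuit (Fin (w ^ d + 1) ⊕ Fin a)),
        (C.depth : ℝ) ≤ K * ((d : ℝ) * Real.logb 2 ((d : ℝ) + 1)) ∧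
        (a : ℝ) ≤ (d : ℝ) * (w : ℝ) ^ d * (2 : ℝ) ^ (A * (w : ℝ)) ∧
        QAC.EpsImplements C (QAC.fanoutGate (w ^ d))
          ((w : ℝ) ^ d / (2 : ℝ) ^ (c * (d : ℝ) * (w : ℝ)))) := by
  refine ⟨1, 8, 182, one_pos, by norm_num, by norm_num, fun d w hd hw => ?_⟩
  have : Nonempty (Fin w) := ⟨⟨0, hw⟩⟩
  have hbase := QAC.hasParity_base (Fin w)
  -- the root of the tree adds a single bit to the target; its 48 ancillae are absorbed in the count
  have hone := QAC.hasParity_base (Fin 1)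
  rw [Fintype.card_fin] at hbase hone
  have htree := QAC.hasParity_pow hbase hone d
  have hd' : (1 : ℝ) ≤ d := by exact_mod_cast hd
  have hlog : 1 ≤ Real.logb 2 ((d : ℝ) + 1) := by
    rw [Real.le_logb_iff_rpow_le (by norm_num) (by positivity), Real.rpow_one]
    linarith
  have hpow : (2 : ℝ) ^ ((8 : ℝ) * (w : ℝ)) = ((2 ^ (8 * w) : ℕ) : ℝ) := by
    rw [Nat.cast_pow, ← Real.rpow_natCast]
    push_cast
    rfl
  have hdepth : ((2 * 60 * d + 60 + 2 : ℕ) : ℝ) ≤ 182 * ((d : ℝ) * Real.logb 2 ((d : ℝ) + 1)) := by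
    push_cast
    nlinarith
  have hcount : ∀ a : ℕ, a ≤ (∑ k ∈ Finset.range d, w ^ k) * (4 ^ (w + 1) * (w + 2) + 1) +
      4 ^ (1 + 1) * (1 + 2) → (a : ℝ) ≤ d * (w : ℝ) ^ d * (2 : ℝ) ^ ((8 : ℝ) * (w : ℝ)) := by
    intro a ha
    rw [hpow]
    exact_mod_cast ha.trans (QAC.tree_ancilla_count_le hd hw)
  refine ⟨?_, ?_, ?_⟩
  -- the circuits are exact, so every nonnegative error bound holds
  · obtain ⟨a, ha, C, hC, h⟩ := hbase.exists_parity
    refine ⟨a, C, ?_, ?_, h _ (by positivity)⟩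
    · rw [hC]
      push_cast
      linarith
    · have h1 : (a : ℝ) ≤ ((2 ^ (8 * w) : ℕ) : ℝ) := by
        have := QAC.ancilla_count_le hw
        exact_mod_cast (by omega : a ≤ 2 ^ (8 * w))
      rw [hpow]
      exact h1.trans (le_mul_of_one_le_left (by positivity) hd')
  · obtain ⟨a, ha, C, hC, h⟩ := htree.exists_parity
    refine ⟨a, C, ?_, hcount a ha, h _ (by positivity)⟩
    rw [hC]
    refine le_trans ?_ hdepth
    exact_mod_cast Nat.le_add_right _ 2
  · obtain ⟨a, ha, C, hC, h⟩ := htree.exists_fanout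
    refine ⟨a, C, ?_, hcount a ha, h _ (by positivity)⟩
    rw [hC]
    exact hdepth
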